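/- **Setting.** Let $\Omega\subset\mathbb R^2$ be a nonempty open convex set with a finite decomposition $\mathcal T_h$ into simple polygons $K$ (hanging nodes are counted as vertices, so that every mesh edge is a full edge of the one or two elements containing it), and let $\mathcal E_h$ be the set of edges, each $e$ with a chosen unit normal $n_e$. Let $k\ge 0$, let $\mathcal P_r$ denote polynomials of degree at most $r$ ($\mathcal P_{-1}=\{0\}$), and let $\Pi^{0,K}_r$, $\boldsymbol\Pi^{0,K}_r$ be the $L^2(K)$-orthogonal projections onto $\mathcal P_r(K)$ and $\mathcal P_r(K)^2$. Let $\Pi^{\nabla,K}_{k+1}:H^1(K)\to\mathcal P_{k+1}(K)$ be the elliptic projection: $(\nabla\Pi^{\nabla,K}_{k+1}z,\nabla p)_K=(\nabla z,\nabla p)_K$ for all $p\in\mathcal P_{k+1}(K)$, and $\Pi^{\nabla,K}_{k+1}z$ has the same mean as $z$ over $\partial K$ if $k=0$, over $K$ if $k\ge1$. The local space $Z_h(K)$ consists of the $z\in H^1(K)$ with $\partial z/\partial n\in\mathcal P_k(e)$ on every edge $e$ of $K$, $\Delta z\in\mathcal P_{k+1}(K)$, and $\int_K(\Pi^{\nabla,K}_{k+1}z)\,p=\int_K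 z\,p$ for all $p\in\mathcal P_{k+1}(K)$ that are $L^2(K)$-orthogonal to $\mathcal P_{k-1}(K)$. The global space is $$Z_h=\Big\{z:\ z|_K\in Z_h(K)\ \forall K\in\mathcal T_h,\quad \int_e[\![z]\!]\,q\,ds=0\ \ \forall q\in\mathcal P_k(e),\ \forall e\in\mathcal E_h\Big\},$$ where $[\![z]\!]$ is the jump across $e$; on boundary edges either of the two conventions $[\![z]\!]=z$ and $[\![z]\!]=0$ may be used throughout. Put $\|z\|_{1,\mathcal T_h}^2=\sum_K(\|z\|_{0,K}^2+\|\nabla z\|_{0,K}^2)$. Let $0<\phi_*\le\phi\le\phi^*$ be measurable and $0<d_m\le d_t\le d_\ell$ be constants, and let $$D(u)=\phi\big[d_mI+|u|\,(d_\ell E(u)+d_t(I-E(u)))\big],\qquad E(u)=\frac{uu^T}{|u|^2}\quad(D(u)=\phi\, d_mI\text{ where }u=0).$$ Let $u=u(t)\in L^\infty(\Omega)^2$ be the velocity at a fixed time. Since integrals over edges occur below, $u$ and $\phi$ are given by Borel representatives on $\overline\Omega$, with $u$ bounded and $\phi_*\le\phi\le\phi^*$ there; any such representatives are allowed. For every $K$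 let $S^K$ be a bilinear form that is symmetric and positive definite on $Z_h(K)$ and satisfies $M_0\|\nabla z\|_{0,K}^2\le S^K(z,z)\le M_1\|\nabla z\|_{0,K}^2$ for all $z\in Z_h(K)\cap\ker\Pi^{\nabla,K}_{k+1}$, with $M_0,M_1>0$ independent of $K$. Let $\nu^K=|\Pi^{0,K}_0\phi|\,(d_m+d_t|\boldsymbol\Pi^{0,K}_0u|)$. For $\lambda>0$, $w,z\in Z_h$ and $c\in H^2(\Omega)$ let $$\begin{aligned}\Gamma_{c,h}(u;w,z)=\sum_K\Big[&\int_K D(u)\boldsymbol\Pi^{0,K}_k\nabla w\cdot\boldsymbol\Pi^{0,K}_k\nabla z+\nu^KS^K\big((I-\Pi^{\nabla,K}_{k+1})w,(I-\Pi^{\nabla,K}_{k+1})z\big)\\&+\int_K u\cdot\boldsymbol\Pi^{0,K}_k\nabla w\;\Pi^{0,K}_{k+1}z+\lambda\int_K\Pi^{0,K}_{k+1}w\,\Pi^{0,K}_{k+1}z\Big],\end{aligned}$$ $$F_c(z)=\sum_K\int_K\big[D(u)\nabla c\cdot\nabla z+(u\cdot\nabla c)\,z+\lambda\,c\,z\big]-\sum_{e\in\mathcal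 E_h}\int_e(D(u)\nabla c\cdot n_e)\,[\![z]\!]\,ds.$$ **Lemma (the projection $\mathcal P_c$ is well defined).** For all $\phi_*,\phi^*,d_m,d_t,d_\ell$ as above and every $M$ there is $\lambda_0>0$, depending on nothing else (in particular neither on the mesh, nor on $k$, nor on the time), such that for all data as above with $\|u\|_{L^\infty(\Omega)}\le M$: 1. for every $\lambda\ge\lambda_0$ the form $\Gamma_{c,h}(u;\cdot,\cdot)$ is coercive on $Z_h$, i.e. there is $\alpha>0$ with $\Gamma_{c,h}(u;z,z)\ge\alpha\|z\|_{1,\mathcal T_h}^2$ for all $z\in Z_h$; 2. for every $\lambda>0$ for which $\Gamma_{c,h}(u;\cdot,\cdot)$ is coercive on $Z_h$, the functional $F_c$ is bounded on $Z_h$ with respect to $\|\cdot\|_{1,\mathcal T_h}$ for every $c\in H^2(\Omega)$, and there is exactly one $\mathcal P_cc\in Z_h$ with $$\Gamma_{c,h}(u;\mathcal P_cc,z_h)=F_c(z_h)\qquad\text{for all }z_h\in Z_h;$$ the operator $\mathcal P_c:H^2(\Omega)\to Z_h$ so defined is linear. -/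

import Mathlib

open MeasureTheory Set Filter Topology
open scoped ENNReal ContDiff Gradient RealInnerProductSpace

noncomputable section

namespace VEM

/-- The plane, with its Euclidean norm. -/
abbrev Pt := EuclideanSpace ℝ (Fin 2)

/-! ### Polynomials -/

/-- Real polynomials in two variables of total degree at most `r`. -/
abbrev Poly (r : ℕ) : Submodule ℝ (MvPolynomial (Fin 2) ℝ) :=
  MvPolynomial.restrictTotalDegree (Fin 2) ℝ r

/-- The function on the plane given by a polynomial. -/
def peval (p : MvPolynomial (Fin 2) ℝ) (x : Pt) : ℝ := MvPolynomial.eval (fun j => x j) p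

/-- The vector field given by a pair of polynomials. -/
def vpeval (p : Fin 2 → MvPolynomial (Fin 2) ℝ) (x : Pt) : Pt :=
  WithLp.toLp 2 (fun j => peval (p j) x)

lemma contDiff_peval (p : MvPolynomial (Fin 2) ℝ) : ContDiff ℝ ∞ (peval p) := by
  unfold peval
  induction p using MvPolynomial.induction_on with
  | C a => simpa using contDiff_const
  | add p q hp hq => simpa using hp.add hq
  | mul_X p i hp =>
    simp only [map_mul, MvPolynomial.eval_X]
    exact hp.mul (by fun_prop)

lemma continuous_gradient {f : Pt → ℝ} (hf : ContDiff ℝ ∞ f) : Continuous (∇ f) := by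
  unfold gradient
  exact (InnerProductSpace.toDual ℝ Pt).symm.continuous.comp (hf.continuous_fderiv (by simp))

lemma gradient_add' {f g : Pt → ℝ} (hf : ContDiff ℝ ∞ f) (hg : ContDiff ℝ ∞ g) :
    ∇ (fun x => f x + g x) = fun x => ∇ f x + ∇ g x := by
  funext x
  unfold gradient
  rw [fderiv_fun_add (hf.differentiable (by simp) x) (hg.differentiable (by simp) x), map_add]

lemma gradient_smul' (a : ℝ) {f : Pt → ℝ} (hf : ContDiff ℝ ∞ f) :
    ∇ (fun x => a * f x) = fun x => a • ∇ f x := by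
  funext x
  unfold gradient
  rw [fderiv_const_mul (hf.differentiable (by simp) x)]
  simp

/-! ### Polygons -/

/-- Arc length measure on the segment from `a` to `b`. -/
def arc (a b : Pt) : Measure Pt :=
  ENNReal.ofReal (dist a b) •
    (volume.restrict (Icc (0 : ℝ) 1)).map (fun s => AffineMap.lineMap a b s)

/-- The unit normal on the segment from `a` to `b`, to the right of the direction of travel. -/
def rightNormal (a b : Pt) : Pt := (dist a b)⁻¹ • !₂[b 1 - a 1, -(b 0 - a 0)]

/-- A simple polygon: a bounded connected open set whose boundary is a simple closed polygonal
curve with vertices `v 0, v 1, …` (at least three, cyclically numbered, traversed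
counterclockwise). Angles of size `π` are allowed, so that hanging nodes count as vertices. -/
structure SimplePolygon where
  m : ℕ
  v : Fin (m + 3) → Pt
  carrier : Set Pt
  isOpen : IsOpen carrier
  isConnected : IsConnected carrier
  isBounded : Bornology.IsBounded carrier
  v_injective : Function.Injective v
  frontier_eq : frontier carrier = ⋃ i, segment ℝ (v i) (v (i + 1))
  /-- distinct edges meet at most in common end points -/
  simple : ∀ i j, i ≠ j → segment ℝ (v i) (v (i + 1)) ∩ segment ℝ (v j) (v (j + 1)) ⊆
    {v i, v (i + 1)} ∩ {v j, v (j + 1)}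
  /-- `rightNormal` is the outward normal on every edge -/
  outward : ∀ i, ∀ s ∈ Ioo (0 : ℝ) 1, ∀ᶠ t in 𝓝[>] (0 : ℝ),
    AffineMap.lineMap (v i) (v (i + 1)) s - t • rightNormal (v i) (v (i + 1)) ∈ carrier ∧
    AffineMap.lineMap (v i) (v (i + 1)) s + t • rightNormal (v i) (v (i + 1)) ∉ carrier

namespace SimplePolygon

variable (K : SimplePolygon)

/-- Lebesgue measure on the polygon. -/
def area : Measure Pt := volume.restrict K.carrier

/-- Arc length on the `i`-th edge. -/
def edge (i : Fin (K.m + 3)) : Measure Pt := arc (K.v i) (K.v (i + 1))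

/-- Arc length on the boundary. -/
def bdry : Measure Pt := ∑ i, K.edge i

end SimplePolygon

instance (a b : Pt) : IsFiniteMeasure (arc a b) := by
  unfold arc
  exact Measure.smul_finite _ ENNReal.ofReal_ne_top

instance (K : SimplePolygon) : IsFiniteMeasure K.area := by
  unfold SimplePolygon.area
  exact ⟨by simpa using K.isBounded.measure_lt_top⟩

instance (K : SimplePolygon) (i : Fin (K.m + 3)) : IsFiniteMeasure (K.edge i) := by
  unfold SimplePolygon.edge; infer_instance

instance (K : SimplePolygon) : IsFiniteMeasure K.bdry := by
  unfold SimplePolygon.bdry; infer_instance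

instance (K : SimplePolygon) : NeZero K.area := by
  refine ⟨fun h => ?_⟩
  have h1 : K.area univ = 0 := by rw [h]; simp
  rw [SimplePolygon.area, Measure.restrict_apply_univ] at h1
  exact (K.isOpen.measure_pos volume K.isConnected.nonempty).ne' h1

lemma measurable_lineMap (a b : Pt) :
    Measurable (fun s : ℝ => (AffineMap.lineMap a b s : Pt)) := by
  have : Continuous (fun s : ℝ => (AffineMap.lineMap a b s : Pt)) := by
    simp only [AffineMap.lineMap_apply]
    fun_prop
  exact this.measurable

lemma arc_univ (a b : Pt) : arc a b univ = ENNReal.ofReal (dist a b) := by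
  simp [arc, Measure.map_apply (measurable_lineMap a b) MeasurableSet.univ]

instance (K : SimplePolygon) : NeZero K.bdry := by
  refine ⟨fun h => ?_⟩
  have h1 : K.bdry univ = 0 := by rw [h]; simp
  have h2 : (0 : Fin (K.m + 3)) ≠ 0 + 1 := by
    intro h; simpa using congrArg Fin.val h
  simp only [SimplePolygon.bdry, SimplePolygon.edge, Measure.finsetSum_apply, arc_univ,
    Finset.sum_eq_zero_iff, ENNReal.ofReal_eq_zero] at h1
  have h3 := h1 0 (Finset.mem_univ _)
  exact h2 (K.v_injective (dist_le_zero.mp h3))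

lemma ae_area_mem (K : SimplePolygon) : ∀ᵐ x ∂K.area, x ∈ closure K.carrier := by
  unfold SimplePolygon.area
  filter_upwards [ae_restrict_mem K.isOpen.measurableSet] with x hx using subset_closure hx

lemma ae_arc_mem (a b : Pt) : ∀ᵐ x ∂arc a b, x ∈ segment ℝ a b := by
  unfold arc
  refine Measure.ae_smul_measure ?_ _
  have hs : MeasurableSet (segment ℝ a b) := by
    have : IsCompact (segment ℝ a b) := by
      rw [segment_eq_image_lineMap]
      exact isCompact_Icc.image AffineMap.lineMap_continuous
    exact this.measurableSet
  refine (ae_map_iff (measurable_lineMap a b).aemeasurable hs).2 ?_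
  filter_upwards [ae_restrict_mem measurableSet_Icc] with s hs
  have : AffineMap.lineMap a b s ∈ segment ℝ a b := by
    rw [segment_eq_image_lineMap]
    exact ⟨s, hs, rfl⟩
  exact this

lemma ae_bdry_mem (K : SimplePolygon) : ∀ᵐ x ∂K.bdry, x ∈ closure K.carrier := by
  have h : ∀ i, ∀ᵐ x ∂K.edge i, x ∈ closure K.carrier := fun i => by
    filter_upwards [ae_arc_mem (K.v i) (K.v (i + 1))] with x hx
    refine frontier_subset_closure ?_
    rw [K.frontier_eq]
    exact mem_iUnion.2 ⟨i, hx⟩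
  have h0 : K.bdry (closure K.carrier)ᶜ = 0 := by
    rw [SimplePolygon.bdry, Measure.finsetSum_apply]
    exact Finset.sum_eq_zero fun i _ => h i
  exact h0

/-- A continuous function is square integrable with respect to a finite measure that is
carried by the closure of a polygon. -/
lemma memLp_of_continuous {F : Type*} [NormedAddCommGroup F] [SecondCountableTopology F]
    [MeasurableSpace F] [BorelSpace F] (K : SimplePolygon)
    {μ : Measure Pt} [IsFiniteMeasure μ] (hμ : ∀ᵐ x ∂μ, x ∈ closure K.carrier)
    {f : Pt → F} (hf : Continuous f) : MemLp f 2 μ := by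
  obtain ⟨C, hC⟩ := (K.isBounded.isCompact_closure).exists_bound_of_continuousOn hf.continuousOn
  exact MemLp.of_bound hf.measurable.aestronglyMeasurable C (hμ.mono fun x hx => hC x hx)

/-! ### Sobolev spaces -/

/-- `g` is the weak gradient of `z` on the open set `U`. -/
def HasWeakGrad (U : Set Pt) (z : Pt → ℝ) (g : Pt → Pt) : Prop :=
  ∀ η : Pt → ℝ, ContDiff ℝ ∞ η → HasCompactSupport η → tsupport η ⊆ U →
    ∀ a : Pt, ∫ x in U, z x * fderiv ℝ η x a = -∫ x in U, ⟪g x, a⟫ * η x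

/-- Triples: a function on `K`, a vector field on `K`, and a function on `∂K`, all in `L²`. -/
abbrev Triple (K : SimplePolygon) :=
  Lp ℝ 2 K.area × Lp Pt 2 K.area × Lp ℝ 2 K.bdry

/-- The triples `(f|_K, ∇f|_K, f|_∂K)` with `f` smooth on the plane. -/
def smoothTriples (K : SimplePolygon) : Submodule ℝ (Triple K) where
  carrier := {w | ∃ f : Pt → ℝ, ContDiff ℝ ∞ f ∧
    w.1 =ᵐ[K.area] f ∧ w.2.1 =ᵐ[K.area] ∇ f ∧ w.2.2 =ᵐ[K.bdry] f}
  zero_mem' := by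
    refine ⟨fun _ => 0, contDiff_const, Lp.coeFn_zero _ _ _, ?_, Lp.coeFn_zero _ _ _⟩
    filter_upwards [Lp.coeFn_zero Pt 2 K.area] with x hx
    exact hx.trans (by simp [gradient])
  add_mem' := by
    rintro w w' ⟨f, hf, h1, h2, h3⟩ ⟨g, hg, h1', h2', h3'⟩
    refine ⟨fun x => f x + g x, hf.add hg, ?_, ?_, ?_⟩
    · filter_upwards [h1, h1', Lp.coeFn_add w.1 w'.1] with x a b c
      exact c.trans (congrArg₂ (· + ·) a b)
    · rw [gradient_add' hf hg]
      filter_upwards [h2, h2', Lp.coeFn_add w.2.1 w'.2.1] with x a b c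
      exact c.trans (congrArg₂ (· + ·) a b)
    · filter_upwards [h3, h3', Lp.coeFn_add w.2.2 w'.2.2] with x a b c
      exact c.trans (congrArg₂ (· + ·) a b)
  smul_mem' := by
    rintro r w ⟨f, hf, h1, h2, h3⟩
    refine ⟨fun x => r * f x, contDiff_const.mul hf, ?_, ?_, ?_⟩
    · filter_upwards [h1, Lp.coeFn_smul r w.1] with x a c
      exact c.trans (congrArg (r • ·) a)
    · rw [gradient_smul' r hf]
      filter_upwards [h2, Lp.coeFn_smul r w.2.1] with x a c
      exact c.trans (congrArg (r • ·) a)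
    · filter_upwards [h3, Lp.coeFn_smul r w.2.2] with x a c
      exact c.trans (congrArg (r • ·) a)

lemma integrable_mul_fderiv {U : Set Pt} {η : Pt → ℝ} (hη : ContDiff ℝ ∞ η)
    (hc : HasCompactSupport η) (a : Pt) (z : Lp ℝ 2 (volume.restrict U)) :
    Integrable (fun x => z x * fderiv ℝ η x a) (volume.restrict U) := by
  have h : Continuous (fun x => fderiv ℝ η x a) :=
    (hη.continuous_fderiv (by simp)).clm_apply continuous_const
  have hm : MemLp (fun x => fderiv ℝ η x a) 2 (volume.restrict U) :=
    (h.memLp_of_hasCompactSupport (hc.fderiv_apply ℝ a)).restrict _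
  exact (Lp.memLp z).integrable_mul hm

lemma integrable_inner_mul {U : Set Pt} {η : Pt → ℝ} (hη : ContDiff ℝ ∞ η)
    (hc : HasCompactSupport η) (a : Pt) (g : Lp Pt 2 (volume.restrict U)) :
    Integrable (fun x => ⟪g x, a⟫ * η x) (volume.restrict U) := by
  have hm : MemLp η 2 (volume.restrict U) :=
    (hη.continuous.memLp_of_hasCompactSupport hc).restrict _
  exact ((Lp.memLp g).inner_const a).integrable_mul hm

/-- The pairs `(z, g)` in `L²(U)` such that `g` is the weak gradient of `z`; this is `H¹(U)`. -/
def weakGradPairs (U : Set Pt) :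
    Submodule ℝ (Lp ℝ 2 (volume.restrict U) × Lp Pt 2 (volume.restrict U)) where
  carrier := {w | HasWeakGrad U w.1 w.2}
  zero_mem' := by
    intro η _ _ _ a
    have h1 : (fun x => (0 : Lp ℝ 2 (volume.restrict U)) x * fderiv ℝ η x a)
        =ᵐ[volume.restrict U] 0 := by
      filter_upwards [Lp.coeFn_zero ℝ 2 (volume.restrict U)] with x hx
      rw [hx]
      simp
    have h2 : (fun x => ⟪(0 : Lp Pt 2 (volume.restrict U)) x, a⟫ * η x)
        =ᵐ[volume.restrict U] 0 := by
      filter_upwards [Lp.coeFn_zero Pt 2 (volume.restrict U)] with x hx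
      rw [hx]
      simp
    simp only [Prod.fst_zero, Prod.snd_zero]
    rw [integral_congr_ae h1, integral_congr_ae h2]
    simp
  add_mem' := by
    rintro w w' h h' η hη hc hs a
    have e1 : (fun x => (w + w').1 x * fderiv ℝ η x a) =ᵐ[volume.restrict U]
        fun x => w.1 x * fderiv ℝ η x a + w'.1 x * fderiv ℝ η x a := by
      filter_upwards [Lp.coeFn_add w.1 w'.1] with x hx
      rw [Prod.fst_add, hx, Pi.add_apply, add_mul]
    have e2 : (fun x => ⟪(w + w').2 x, a⟫ * η x) =ᵐ[volume.restrict U]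
        fun x => ⟪w.2 x, a⟫ * η x + ⟪w'.2 x, a⟫ * η x := by
      filter_upwards [Lp.coeFn_add w.2 w'.2] with x hx
      rw [Prod.snd_add, hx, Pi.add_apply, inner_add_left, add_mul]
    rw [integral_congr_ae e1, integral_congr_ae e2,
      integral_add (integrable_mul_fderiv hη hc a _) (integrable_mul_fderiv hη hc a _),
      integral_add (integrable_inner_mul hη hc a _) (integrable_inner_mul hη hc a _),
      h η hη hc hs a, h' η hη hc hs a]
    ring
  smul_mem' := by
    rintro r w h η hη hc hs a
    have e1 : (fun x => (r • w).1 x * fderiv ℝ η x a) =ᵐ[volume.restrict U]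
        fun x => r * (w.1 x * fderiv ℝ η x a) := by
      filter_upwards [Lp.coeFn_smul r w.1] with x hx
      rw [Prod.smul_fst, hx, Pi.smul_apply, smul_eq_mul, mul_assoc]
    have e2 : (fun x => ⟪(r • w).2 x, a⟫ * η x) =ᵐ[volume.restrict U]
        fun x => r * (⟪w.2 x, a⟫ * η x) := by
      filter_upwards [Lp.coeFn_smul r w.2] with x hx
      rw [Prod.smul_snd, hx, Pi.smul_apply, real_inner_smul_left, mul_assoc]
    rw [integral_congr_ae e1, integral_congr_ae e2, integral_const_mul, integral_const_mul,
      h η hη hc hs a]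
    ring

/-- `H¹(K)`. An element is stored as the triple of a function `z` in `L²(K)`, its weak gradient
in `L²(K)²`, and its trace in `L²(∂K)`; gradient and trace are determined by `z`. The trace is
the `L²(∂K)`-limit of the restrictions of smooth functions that converge to `z` in `H¹(K)`. -/
def H1 (K : SimplePolygon) : Submodule ℝ (Triple K) :=
  (weakGradPairs K.carrier).comap
      ((LinearMap.fst ℝ _ _).prod ((LinearMap.fst ℝ _ _).comp (LinearMap.snd ℝ _ _))) ⊓
    (smoothTriples K).topologicalClosure

/-- The function `z` itself, for `z` in `H¹(K)`. -/
def fn {K : SimplePolygon} (z : H1 K) : Lp ℝ 2 K.area := z.1.1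

/-- The weak gradient of `z`. -/
def grad {K : SimplePolygon} (z : H1 K) : Lp Pt 2 K.area := z.1.2.1

/-- The trace of `z` on the boundary. -/
def tr {K : SimplePolygon} (z : H1 K) : Lp ℝ 2 K.bdry := z.1.2.2

lemma hasWeakGrad_of_contDiff (K : SimplePolygon) {f : Pt → ℝ} (hf : ContDiff ℝ ∞ f) :
    HasWeakGrad K.carrier f (∇ f) := by
  intro η hη hc hs a
  have hη0 : ∀ x, x ∉ K.carrier → η x = 0 := fun x hx =>
    image_eq_zero_of_notMem_tsupport fun h => hx (hs h)
  have hη1 : ∀ x, x ∉ K.carrier → fderiv ℝ η x a = 0 := fun x hx => by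
    have : fderiv ℝ η x = 0 :=
      image_eq_zero_of_notMem_tsupport fun h => hx (hs (tsupport_fderiv_subset ℝ h))
    simp [this]
  rw [setIntegral_eq_integral_of_forall_compl_eq_zero (fun x hx => by simp [hη1 x hx]),
    setIntegral_eq_integral_of_forall_compl_eq_zero (fun x hx => by simp [hη0 x hx])]
  have hfc := hf.continuous
  have hηc := hη.continuous
  have hf' : Continuous (fun x => fderiv ℝ f x a) :=
    (hf.continuous_fderiv (by simp)).clm_apply continuous_const
  have hη' : Continuous (fun x => fderiv ℝ η x a) :=
    (hη.continuous_fderiv (by simp)).clm_apply continuous_const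
  simp only [inner_gradient_left]
  exact integral_mul_fderiv_eq_neg_fderiv_mul_of_integrable
    ((hf'.mul hηc).integrable_of_hasCompactSupport hc.mul_left)
    ((hfc.mul hη').integrable_of_hasCompactSupport (hc.fderiv_apply ℝ a).mul_left)
    ((hfc.mul hηc).integrable_of_hasCompactSupport hc.mul_left)
    (fun x _ => hf.differentiable (by simp) x) (fun x _ => hη.differentiable (by simp) x)

/-- A polynomial, as an element of `H¹(K)`. -/
def polyH1 (K : SimplePolygon) (p : MvPolynomial (Fin 2) ℝ) : H1 K :=
  ⟨((memLp_of_continuous K (ae_area_mem K) (contDiff_peval p).continuous).toLp (peval p),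
    (memLp_of_continuous K (ae_area_mem K) (continuous_gradient (contDiff_peval p))).toLp
      (∇ (peval p)),
    (memLp_of_continuous K (ae_bdry_mem K) (contDiff_peval p).continuous).toLp (peval p)), by
    refine ⟨?_, Submodule.le_topologicalClosure _ ⟨peval p, contDiff_peval p,
      MemLp.coeFn_toLp (memLp_of_continuous K (ae_area_mem K) (contDiff_peval p).continuous),
      MemLp.coeFn_toLp (memLp_of_continuous K (ae_area_mem K)
        (continuous_gradient (contDiff_peval p))),
      MemLp.coeFn_toLp (memLp_of_continuous K (ae_bdry_mem K)
        (contDiff_peval p).continuous)⟩⟩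
    intro η hη hc hs a
    refine Eq.trans (integral_congr_ae ?_) ((hasWeakGrad_of_contDiff K (contDiff_peval p)
      η hη hc hs a).trans (congrArg Neg.neg (integral_congr_ae ?_)))
    · filter_upwards [MemLp.coeFn_toLp (memLp_of_continuous K (ae_area_mem K)
        (contDiff_peval p).continuous)] with x hx
      exact congrArg (· * _) hx
    · filter_upwards [MemLp.coeFn_toLp (memLp_of_continuous K (ae_area_mem K)
        (continuous_gradient (contDiff_peval p)))] with x hx
      exact congrArg (fun y => ⟪y, a⟫ * η x) hx.symm⟩

/-! ### Projections onto polynomials -/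

lemma peval_add (p q : MvPolynomial (Fin 2) ℝ) : peval (p + q) = fun x => peval p x + peval q x := by
  funext x; simp [peval]

lemma peval_smul (r : ℝ) (p : MvPolynomial (Fin 2) ℝ) : peval (r • p) = fun x => r * peval p x := by
  funext x; simp [peval, MvPolynomial.smul_eval]

/-- Polynomials of degree at most `r`, as elements of `L²(K)`. -/
def polyToL2 (K : SimplePolygon) (r : ℕ) : Poly r →ₗ[ℝ] Lp ℝ 2 K.area where
  toFun p := (memLp_of_continuous K (ae_area_mem K) (contDiff_peval p.1).continuous).toLp
    (peval p.1)
  map_add' p q := by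
    rw [← MemLp.toLp_add]
    congr 1
    exact peval_add _ _
  map_smul' s p := by
    simp only [RingHom.id_apply]
    rw [← MemLp.toLp_const_smul]
    congr 1
    exact peval_smul _ _

lemma continuous_vpeval (p : Fin 2 → MvPolynomial (Fin 2) ℝ) : Continuous (vpeval p) := by
  unfold vpeval
  exact (PiLp.continuous_toLp 2 _).comp
    (continuous_pi fun j => (contDiff_peval (p j)).continuous)

/-- Vector fields with polynomial components of degree at most `r`, as elements of `L²(K)²`. -/
def vpolyToL2 (K : SimplePolygon) (r : ℕ) : (Fin 2 → Poly r) →ₗ[ℝ] Lp Pt 2 K.area where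
  toFun p := (memLp_of_continuous K (ae_area_mem K)
    (continuous_vpeval fun j => (p j).1)).toLp (vpeval fun j => (p j).1)
  map_add' p q := by
    rw [← MemLp.toLp_add]
    congr 1
    funext x
    ext j
    simp [vpeval, peval_add]
  map_smul' s p := by
    simp only [RingHom.id_apply]
    rw [← MemLp.toLp_const_smul]
    congr 1
    funext x
    ext j
    simp [vpeval, peval_smul]

/-- The `L²(K)`-orthogonal projection onto the polynomials of degree at most `r`. -/
def proj (K : SimplePolygon) (r : ℕ) : Lp ℝ 2 K.area →L[ℝ] Lp ℝ 2 K.area :=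
  (LinearMap.range (polyToL2 K r)).starProjection

/-- The `L²(K)²`-orthogonal projection onto the vector fields with polynomial components of
degree at most `r`. -/
def vproj (K : SimplePolygon) (r : ℕ) : Lp Pt 2 K.area →L[ℝ] Lp Pt 2 K.area :=
  (LinearMap.range (vpolyToL2 K r)).starProjection

/-- `p` is the elliptic projection of `z` onto the polynomials of degree at most `k + 1`. -/
def IsEllProj (K : SimplePolygon) (k : ℕ) (z : H1 K) (p : MvPolynomial (Fin 2) ℝ) : Prop :=
  p ∈ Poly (k + 1) ∧
  (∀ q ∈ Poly (k + 1),
    ∫ x, ⟪∇ (peval p) x, ∇ (peval q) x⟫ ∂K.area = ∫ x, ⟪grad z x, ∇ (peval q) x⟫ ∂K.area) ∧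
  (k = 0 → ⨍ x, peval p x ∂K.bdry = ⨍ x, tr z x ∂K.bdry) ∧
  (1 ≤ k → ⨍ x, peval p x ∂K.area = ⨍ x, fn z x ∂K.area)

/-- Gradients of polynomials of degree at most `r`, as elements of `L²(K)²`. -/
def gradPolyToL2 (K : SimplePolygon) (r : ℕ) : Poly r →ₗ[ℝ] Lp Pt 2 K.area where
  toFun p := (memLp_of_continuous K (ae_area_mem K)
    (continuous_gradient (contDiff_peval p.1))).toLp (∇ (peval p.1))
  map_add' p q := by
    rw [← MemLp.toLp_add]
    congr 1
    change ∇ (peval (p.1 + q.1)) = _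
    rw [peval_add, gradient_add' (contDiff_peval _) (contDiff_peval _)]
    rfl
  map_smul' s p := by
    simp only [RingHom.id_apply]
    rw [← MemLp.toLp_const_smul]
    congr 1
    change ∇ (peval (s • p.1)) = _
    rw [peval_smul, gradient_smul' s (contDiff_peval _)]
    rfl

lemma exists_isEllProj (K : SimplePolygon) (k : ℕ) (z : H1 K) : ∃ p, IsEllProj K k z p := by
  let W := LinearMap.range (gradPolyToL2 K (k + 1))
  obtain ⟨p, hp⟩ : W.starProjection (grad z) ∈ W := Submodule.starProjection_apply_mem _ _
  have key : ∀ q ∈ Poly (k + 1),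
      ∫ x, ⟪∇ (peval p.1) x, ∇ (peval q) x⟫ ∂K.area
        = ∫ x, ⟪grad z x, ∇ (peval q) x⟫ ∂K.area := by
    intro q hq
    have h0 := Submodule.starProjection_inner_eq_zero (K := W) (grad z)
      (gradPolyToL2 K (k + 1) ⟨q, hq⟩) ⟨_, rfl⟩
    rw [inner_sub_left, sub_eq_zero, ← hp, L2.inner_def, L2.inner_def] at h0
    have hP := MemLp.coeFn_toLp (memLp_of_continuous K (ae_area_mem K)
      (continuous_gradient (contDiff_peval p.1)))
    have hQ := MemLp.coeFn_toLp (memLp_of_continuous K (ae_area_mem K)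
      (continuous_gradient (contDiff_peval q)))
    refine Eq.trans (integral_congr_ae ?_) (h0.symm.trans (integral_congr_ae ?_))
    · filter_upwards [hP, hQ] with x a b
      exact (congrArg₂ (fun y w => ⟪y, w⟫) a b).symm
    · filter_upwards [hQ] with x b
      exact congrArg (fun w => ⟪grad z x, w⟫) b
  have hC : ∀ c : ℝ, peval (p.1 + MvPolynomial.C c) = fun x => peval p.1 x + c := fun c => by
    funext x; simp [peval]
  have hG : ∀ c : ℝ, ∇ (peval (p.1 + MvPolynomial.C c)) = ∇ (peval p.1) := fun c => by
    funext x; rw [hC]; simp [gradient]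
  have hM : ∀ c : ℝ, p.1 + MvPolynomial.C c ∈ Poly (k + 1) := fun c => by
    refine Submodule.add_mem _ p.2 ?_
    rw [MvPolynomial.mem_restrictTotalDegree]
    simp
  have hA : ∀ (μ : Measure Pt) [IsFiniteMeasure μ] [NeZero μ], (∀ᵐ x ∂μ, x ∈ closure K.carrier) →
      ∀ t : ℝ, ⨍ x, peval (p.1 + MvPolynomial.C (t - ⨍ x, peval p.1 x ∂μ)) x ∂μ = t := by
    intro μ _ _ hμ t
    rw [hC]
    have hi : Integrable (peval p.1) μ :=
      (memLp_of_continuous K hμ (contDiff_peval p.1).continuous).integrable (by norm_num)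
    have h1 : ∀ c : ℝ, ⨍ x, (peval p.1 x + c) ∂μ = (⨍ x, peval p.1 x ∂μ) + c := fun c => by
      have h2 := average_const μ c
      simp only [average_eq] at h2 ⊢
      rw [integral_add hi (integrable_const c), smul_add, h2]
    rw [h1]; ring
  rcases Nat.eq_zero_or_pos k with hk | hk
  · exact ⟨_, hM _, fun q hq => by rw [hG]; exact key q hq,
      fun _ => hA K.bdry (ae_bdry_mem K) _, fun h => by omega⟩
  · exact ⟨_, hM _, fun q hq => by rw [hG]; exact key q hq,
      fun h => by omega, fun _ => hA K.area (ae_area_mem K) _⟩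

/-- The elliptic projection onto the polynomials of degree at most `k + 1`. (It is unique, since
`K` is open and not empty.) -/
def ellProj (K : SimplePolygon) (k : ℕ) (z : H1 K) : H1 K :=
  polyH1 K (exists_isEllProj K k z).choose

/-! ### Virtual elements -/

/-- `z ∈ H¹(K)` has Laplacian (the polynomial) `f` in `K` and normal derivative (the polynomial)
`g i` on the `i`-th edge, in the weak sense. -/
def HasLaplacianNormal {K : SimplePolygon} (z : H1 K) (f : MvPolynomial (Fin 2) ℝ)
    (g : Fin (K.m + 3) → MvPolynomial (Fin 2) ℝ) : Prop :=
  ∀ w : H1 K, ∫ x, ⟪grad z x, grad w x⟫ ∂K.area + ∫ x, peval f x * fn w x ∂K.area =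
    ∑ i, ∫ x, peval (g i) x * tr w x ∂K.edge i

/-- The local virtual element space for the concentration: the normal derivative is a polynomial
of degree at most `k` on every edge, the Laplacian is a polynomial of degree at most `k + 1`, and
the elliptic projection of `z` has the same moments as `z` against all polynomials of degree at
most `k + 1` that are orthogonal in `L²(K)` to those of degree at most `k - 1`. -/
def LocalZh (K : SimplePolygon) (k : ℕ) : Set (H1 K) :=
  {z | (∃ f ∈ Poly (k + 1), ∃ g : Fin (K.m + 3) → MvPolynomial (Fin 2) ℝ,
      (∀ i, g i ∈ Poly k) ∧ HasLaplacianNormal z f g) ∧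
    ∀ p ∈ Poly (k + 1),
      (∀ q : MvPolynomial (Fin 2) ℝ, q.totalDegree < k →
        ∫ x, peval p x * peval q x ∂K.area = 0) →
      ∫ x, fn (ellProj K k z) x * peval p x ∂K.area = ∫ x, fn z x * peval p x ∂K.area}

/-- `S` is an admissible stabilisation on `K` with constants `M₀`, `M₁`: a bilinear form,
symmetric and positive definite on the local space, and comparable with `‖∇ ·‖²` on the functions
of the local space that the elliptic projection annihilates, that is, on the functions
`z - ellProj z` with `z` in the local space (which contains the polynomials of degree at most
`k + 1`). Its values outside the local space are irrelevant. -/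
structure IsStabilization (K : SimplePolygon) (k : ℕ) (S : LinearMap.BilinForm ℝ (H1 K))
    (M₀ M₁ : ℝ) : Prop where
  symm : ∀ z ∈ LocalZh K k, ∀ w ∈ LocalZh K k, S z w = S w z
  pos : ∀ z ∈ LocalZh K k, z ≠ 0 → 0 < S z z
  lower : ∀ z ∈ LocalZh K k,
    M₀ * ‖grad (z - ellProj K k z)‖ ^ 2 ≤ S (z - ellProj K k z) (z - ellProj K k z)
  upper : ∀ z ∈ LocalZh K k,
    S (z - ellProj K k z) (z - ellProj K k z) ≤ M₁ * ‖grad (z - ellProj K k z)‖ ^ 2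

/-! ### Meshes -/

/-- A decomposition of `Ω` into simple polygons. A side is an edge of an element. Every side
belongs to exactly one mesh edge; a mesh edge `e` has a `left` side, whose outward normal is the
normal chosen on `e`, and it either has a `right` side, an edge of the neighbouring element with
the same end points, or lies on the boundary of `Ω`. -/
structure Mesh (Ω : Set Pt) where
  ι : Type
  [fintypeι : Fintype ι]
  elem : ι → SimplePolygon
  subset : ∀ K, (elem K).carrier ⊆ Ω
  disjoint : Pairwise fun K L => Disjoint (elem K).carrier (elem L).carrier
  cover : closure Ω = ⋃ K, closure (elem K).carrier
  ε : Type
  [fintypeε : Fintype ε]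
  left : ε → (K : ι) × Fin ((elem K).m + 3)
  right : ε → Option ((K : ι) × Fin ((elem K).m + 3))
  side_unique : ∀ s, ∃! e, left e = s ∨ right e = some s
  right_matches : ∀ e s, right e = some s →
    (elem s.1).v s.2 = (elem (left e).1).v ((left e).2 + 1) ∧
    (elem s.1).v (s.2 + 1) = (elem (left e).1).v (left e).2
  boundary : ∀ e, right e = none →
    segment ℝ ((elem (left e).1).v (left e).2) ((elem (left e).1).v ((left e).2 + 1)) ⊆ frontier Ω

attribute [instance] Mesh.fintypeι Mesh.fintypeε

namespace Mesh

variable {Ω : Set Pt} (T : Mesh Ω)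

/-- Arc length on a mesh edge. -/
def edge (e : T.ε) : Measure Pt := (T.elem (T.left e).1).edge (T.left e).2

/-- The unit normal of a mesh edge. -/
def normal (e : T.ε) : Pt :=
  rightNormal ((T.elem (T.left e).1).v (T.left e).2) ((T.elem (T.left e).1).v ((T.left e).2 + 1))

/-- The broken Sobolev space `H¹(𝒯)`; an element is the family of its restrictions to the
elements of the mesh. -/
abbrev BrokenH1 := (K : T.ι) → H1 (T.elem K)

/-- The square of the broken `H¹` norm. -/
def normSq (z : T.BrokenH1) : ℝ := ∑ K, (‖fn (z K)‖ ^ 2 + ‖grad (z K)‖ ^ 2)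

/-- The jump across a mesh edge. On a boundary edge it is the trace if `bd = true` and it is `0` if
`bd = false`. -/
def jump (bd : Bool) (z : T.BrokenH1) (e : T.ε) (x : Pt) : ℝ :=
  match T.right e with
  | some s => tr (z (T.left e).1) x - tr (z s.1) x
  | none => if bd then tr (z (T.left e).1) x else 0

/-- The global nonconforming virtual element space for the concentration. -/
def Zh (bd : Bool) (k : ℕ) : Set T.BrokenH1 :=
  {z | (∀ K, z K ∈ LocalZh (T.elem K) k) ∧
    ∀ e, ∀ q ∈ Poly k, ∫ x, T.jump bd z e x * peval q x ∂T.edge e = 0}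

end Mesh

/-! ### The space `H²(Ω)` -/

/-- Data for a function in `H²(Ω)`: the function, its gradient, and the trace of the gradient on
the boundaries of all mesh elements. -/
abbrev H2Data {Ω : Set Pt} (T : Mesh Ω) :=
  Lp ℝ 2 (volume.restrict Ω) × Lp Pt 2 (volume.restrict Ω) ×
    ((K : T.ι) → Lp Pt 2 (T.elem K).bdry)

/-- `H²(Ω)`. An element is stored as the triple of a function `c` in `L²(Ω)`, its weak gradient,
every component of which has in turn a weak gradient in `L²(Ω)²`, and the traces of the gradient
on the boundaries of the mesh elements; gradient and traces are determined by `c`. -/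
def H2 {Ω : Set Pt} (T : Mesh Ω) : Submodule ℝ (H2Data T) where
  carrier := {w | (w.1, w.2.1) ∈ weakGradPairs Ω ∧ ∀ a : Pt,
    ∃ y ∈ weakGradPairs Ω, (y.1 =ᵐ[volume.restrict Ω] fun x => ⟪w.2.1 x, a⟫) ∧
      ∀ K, ∃ z : H1 (T.elem K), fn z =ᵐ[(T.elem K).area] y.1 ∧ grad z =ᵐ[(T.elem K).area] y.2 ∧
        tr z =ᵐ[(T.elem K).bdry] fun x => ⟪w.2.2 K x, a⟫}
  zero_mem' := by
    refine ⟨(weakGradPairs Ω).zero_mem, fun a => ⟨0, (weakGradPairs Ω).zero_mem, ?_, fun K =>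
      ⟨0, ?_, ?_, ?_⟩⟩⟩
    · filter_upwards [Lp.coeFn_zero ℝ 2 (volume.restrict Ω),
        Lp.coeFn_zero Pt 2 (volume.restrict Ω)] with x h1 h2
      refine h1.trans ?_
      change _ = ⟪(0 : Lp Pt 2 (volume.restrict Ω)) x, a⟫
      rw [h2]; simp
    · filter_upwards [Lp.coeFn_zero ℝ 2 (T.elem K).area, ae_restrict_of_ae_restrict_of_subset
        (T.subset K) (Lp.coeFn_zero ℝ 2 (volume.restrict Ω))] with x h1 h2
      exact h1.trans h2.symm
    · filter_upwards [Lp.coeFn_zero Pt 2 (T.elem K).area, ae_restrict_of_ae_restrict_of_subset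
        (T.subset K) (Lp.coeFn_zero Pt 2 (volume.restrict Ω))] with x h1 h2
      exact h1.trans h2.symm
    · filter_upwards [Lp.coeFn_zero ℝ 2 (T.elem K).bdry,
        Lp.coeFn_zero Pt 2 (T.elem K).bdry] with x h1 h2
      refine h1.trans ?_
      change _ = ⟪(0 : Lp Pt 2 (T.elem K).bdry) x, a⟫
      rw [h2]; simp
  add_mem' := by
    rintro w w' ⟨h, H⟩ ⟨h', H'⟩
    refine ⟨(weakGradPairs Ω).add_mem h h', fun a => ?_⟩
    obtain ⟨y, hy, hv, hK⟩ := H a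
    obtain ⟨y', hy', hv', hK'⟩ := H' a
    refine ⟨y + y', (weakGradPairs Ω).add_mem hy hy', ?_, fun K => ?_⟩
    · filter_upwards [hv, hv', Lp.coeFn_add y.1 y'.1, Lp.coeFn_add w.2.1 w'.2.1] with x b b' c d
      refine c.trans ((congrArg₂ (· + ·) b b').trans ?_)
      change _ = ⟪(w.2.1 + w'.2.1) x, a⟫
      rw [d, Pi.add_apply, inner_add_left]
    · obtain ⟨z, h1, h2, h3⟩ := hK K
      obtain ⟨z', h1', h2', h3'⟩ := hK' K
      refine ⟨z + z', ?_, ?_, ?_⟩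
      · filter_upwards [h1, h1', Lp.coeFn_add (fn z) (fn z'), ae_restrict_of_ae_restrict_of_subset
          (T.subset K) (Lp.coeFn_add y.1 y'.1)] with x b b' c d
        exact c.trans ((congrArg₂ (· + ·) b b').trans d.symm)
      · filter_upwards [h2, h2', Lp.coeFn_add (grad z) (grad z'),
          ae_restrict_of_ae_restrict_of_subset (T.subset K) (Lp.coeFn_add y.2 y'.2)] with x b b' c d
        exact c.trans ((congrArg₂ (· + ·) b b').trans d.symm)
      · filter_upwards [h3, h3', Lp.coeFn_add (tr z) (tr z'),
          Lp.coeFn_add (w.2.2 K) (w'.2.2 K)] with x b b' c d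
        refine c.trans ((congrArg₂ (· + ·) b b').trans ?_)
        change _ = ⟪(w.2.2 K + w'.2.2 K) x, a⟫
        rw [d, Pi.add_apply, inner_add_left]
  smul_mem' := by
    rintro r w ⟨h, H⟩
    refine ⟨(weakGradPairs Ω).smul_mem r h, fun a => ?_⟩
    obtain ⟨y, hy, hv, hK⟩ := H a
    refine ⟨r • y, (weakGradPairs Ω).smul_mem r hy, ?_, fun K => ?_⟩
    · filter_upwards [hv, Lp.coeFn_smul r y.1, Lp.coeFn_smul r w.2.1] with x b c d
      refine c.trans ((congrArg (r • ·) b).trans ?_)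
      change _ = ⟪(r • w.2.1) x, a⟫
      rw [d, Pi.smul_apply, real_inner_smul_left, smul_eq_mul]
    · obtain ⟨z, h1, h2, h3⟩ := hK K
      refine ⟨r • z, ?_, ?_, ?_⟩
      · filter_upwards [h1, Lp.coeFn_smul r (fn z), ae_restrict_of_ae_restrict_of_subset
          (T.subset K) (Lp.coeFn_smul r y.1)] with x b c d
        exact c.trans ((congrArg (r • ·) b).trans d.symm)
      · filter_upwards [h2, Lp.coeFn_smul r (grad z), ae_restrict_of_ae_restrict_of_subset
          (T.subset K) (Lp.coeFn_smul r y.2)] with x b c d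
        exact c.trans ((congrArg (r • ·) b).trans d.symm)
      · filter_upwards [h3, Lp.coeFn_smul r (tr z), Lp.coeFn_smul r (w.2.2 K)] with x b c d
        refine c.trans ((congrArg (r • ·) b).trans ?_)
        change _ = ⟪(r • w.2.2 K) x, a⟫
        rw [d, Pi.smul_apply, real_inner_smul_left, smul_eq_mul]

/-! ### The forms -/

/-- The tensor `E(u) = u uᵀ / |u|²`. -/
def dirTensor (u : Pt) : Pt →L[ℝ] Pt := (‖u‖ ^ 2)⁻¹ • (innerSL ℝ u).smulRight u

/-- The coefficients: porosity, molecular diffusion, longitudinal and transversal dispersion. -/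
structure Coeff where
  φ : Pt → ℝ
  dm : ℝ
  dl : ℝ
  dt : ℝ

/-- The diffusion-dispersion tensor `D(u)` at the point `x`. -/
def Coeff.D (C : Coeff) (u : Pt → Pt) (x : Pt) : Pt →L[ℝ] Pt :=
  C.φ x • (C.dm • ContinuousLinearMap.id ℝ Pt + ‖u x‖ • (C.dl • dirTensor (u x) +
    C.dt • (ContinuousLinearMap.id ℝ Pt - dirTensor (u x))))

/-- The weight of the stabilisation on `K`, formed with the mean values of `φ` and `u`. -/
def Coeff.ν (C : Coeff) (u : Pt → Pt) (K : SimplePolygon) : ℝ :=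
  |⨍ x, C.φ x ∂K.area| * (C.dm + C.dt * ‖⨍ x, u x ∂K.area‖)

section forms

variable {Ω : Set Pt} (T : Mesh Ω) (k : ℕ) (C : Coeff) (u : Pt → Pt)
  (S : (K : T.ι) → LinearMap.BilinForm ℝ (H1 (T.elem K))) (lam : ℝ) (bd : Bool)

/-- The discrete diffusion form. -/
def Dh (c z : T.BrokenH1) : ℝ :=
  ∑ K, ∫ x, ⟪C.D u x (vproj (T.elem K) k (grad (c K)) x), vproj (T.elem K) k (grad (z K)) x⟫
    ∂(T.elem K).area +
  ∑ K, C.ν u (T.elem K) *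
    S K (c K - ellProj (T.elem K) k (c K)) (z K - ellProj (T.elem K) k (z K))

/-- The discrete convection form. -/
def Θh (c z : T.BrokenH1) : ℝ :=
  ∑ K, ∫ x, ⟪u x, vproj (T.elem K) k (grad (c K)) x⟫ * proj (T.elem K) (k + 1) (fn (z K)) x
    ∂(T.elem K).area

/-- The discrete `L²` product. -/
def massh (c z : T.BrokenH1) : ℝ :=
  ∑ K, ∫ x, proj (T.elem K) (k + 1) (fn (c K)) x * proj (T.elem K) (k + 1) (fn (z K)) x
    ∂(T.elem K).area

/-- The discrete form `Γ_{c,h}(u; ·, ·)`. -/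
def Γh (c z : T.BrokenH1) : ℝ :=
  Dh T k C u S c z + Θh T k u c z + lam * massh T k c z

/-- The piecewise form `Γ_{c,pw}(u; c, ·)` for `c` in `H²(Ω)`. -/
def Γpw (c : H2 T) (z : T.BrokenH1) : ℝ :=
  ∑ K, ∫ x, ⟪C.D u x (c.1.2.1 x), grad (z K) x⟫ ∂(T.elem K).area +
  ∑ K, ∫ x, ⟪u x, c.1.2.1 x⟫ * fn (z K) x ∂(T.elem K).area +
  lam * ∑ K, ∫ x, c.1.1 x * fn (z K) x ∂(T.elem K).area

/-- The nonconformity term `𝒩_h(u; c, ·)` for `c` in `H²(Ω)`. -/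
def Nh (c : H2 T) (z : T.BrokenH1) : ℝ :=
  ∑ e, ∫ x, ⟪C.D u x (c.1.2.2 (T.left e).1 x), T.normal e⟫ * T.jump bd z e x ∂T.edge e

/-- The right-hand side of the equation that defines the projection of `c`. -/
def rhs (c : H2 T) (z : T.BrokenH1) : ℝ := Γpw T C u lam c z - Nh T C u bd c z

/-- Coercivity of `Γ_{c,h}(u; ·, ·)` on the virtual element space, in the broken `H¹` norm. -/
def Coercive : Prop :=
  ∃ α > 0, ∀ z ∈ T.Zh bd k, α * T.normSq z ≤ Γh T k C u S lam z z

end forms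

end VEM

end

open VEM

noncomputable section

namespace VEM

/-! ### Functions with vanishing weak gradient -/

/-! On one element let a and b be the polynomial projections of ∇z and z (`vproj`, `proj`), and let
r = ∇(z − Π^∇ z). Since 0 ≤ E(u) ≤ I, diffusion contributes at least c‖a‖² with c = φlo·dm.
Convection is at least −M‖a‖‖b‖, and Young's inequality bounds this loss by c/2 ‖a‖² + M²/(2c) ‖b‖².
Hence λ₀ = M²/(2c) + 1 leaves c/2 ‖a‖² + ‖b‖² + ν M₀‖r‖² on every element (`le_element_form`). If
that quantity is zero, then ∇z is the gradient of a polynomial of degree at most k + 1. The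
projection fixes such a gradient, so ∇z = a = 0; then z is constant, hence equal to its projection b
= 0 (`eq_zero_of_projections_eq_zero`). So Γ is positive definite on Z_h (`Γh_self_pos`).

The rest is finite-dimensional linear algebra. A positive definite form on Z_h is coercive by
compactness of the unit sphere (`coercive_of_pos`), every linear functional on Z_h is bounded
(`exists_abs_le_mul_sqrt_normSq`), and a definite form identifies Z_h with its dual, which yields
𝒫_c together with its linearity (`exists_linear_representation`). The coercivity constant and the
bound on the functional may depend on the mesh; λ₀ does not.

Finite dimension is proved elementwise (`finiteDimensional_lapSpace`): z ↦ (∇z, ∇·) sends the local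
space into functionals given by finitely many polynomial coefficients, and its kernel consists of
constants. Two analytic facts enter. A function with zero weak gradient on a connected open set is
constant, by mollification (`ae_const_of_hasWeakGrad_zero`). And the trace stored in an element of
H¹(K) is determined by the function and its gradient (`triple_eq_zero`), by a local trace inequality
on a thin strip along each edge. -/

lemma fderiv_comp_sub_left {g : Pt → ℝ} (hg : Differentiable ℝ g) (x t a : Pt) :
    fderiv ℝ (fun t => g (x - t)) t a = -(fderiv ℝ g (x - t) a) := by
  have h1 : HasFDerivAt (fun t => g (x - t)) _ t :=
    (hg (x - t)).hasFDerivAt.comp t ((hasFDerivAt_id t).const_sub x)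
  rw [h1.fderiv]
  simp

/-- Mollification: the derivative of the mollified function at a point of the smaller ball is, up to
sign, the pairing of z with the derivative of a test function supported in U, hence zero. The
mollifications are therefore constant on that ball, and they converge to z almost everywhere. -/
lemma ae_const_ball_of_hasWeakGrad_zero {U : Set Pt} (hU : IsOpen U) {z : Pt → ℝ}
    (hz : IntegrableOn z U) (h : HasWeakGrad U z 0) {x₀ : Pt} {r : ℝ} (hr : 0 < r)
    (hsub : Metric.ball x₀ (2 * r) ⊆ U) :
    ∃ c, ∀ᵐ x ∂volume, x ∈ Metric.ball x₀ r → z x = c := by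
  set w : Pt → ℝ := U.indicator z with hw
  have hwi : Integrable w := hz.integrable_indicator hU.measurableSet
  have hwl : LocallyIntegrable w := hwi.locallyIntegrable
  -- The outer radius is twice the inner one because the almost-everywhere convergence theorem needs
  -- a bounded ratio; the 4 makes every outer radius smaller than r.
  let φ : ℕ → ContDiffBump (0 : Pt) := fun n =>
    ⟨r / (n + 4), 2 * (r / (n + 4)), by positivity, by
      have : 0 < r / ((n : ℝ) + 4) := by positivity
      linarith⟩
  have hφr : ∀ n, (φ n).rOut < r := fun n => by
    change 2 * (r / ((n : ℝ) + 4)) < r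
    rw [← mul_div_assoc, div_lt_iff₀ (by positivity)]
    nlinarith [(Nat.cast_nonneg n : (0 : ℝ) ≤ n)]
  have hφ0 : Tendsto (fun n => (φ n).rOut) atTop (𝓝 0) := by
    have h1 : Tendsto (fun n : ℕ => r / ((n : ℝ) + 4)) atTop (𝓝 0) :=
      tendsto_const_nhds.div_atTop
        (tendsto_atTop_add_const_right _ _ tendsto_natCast_atTop_atTop)
    simpa using h1.const_mul 2
  have hlim := ContDiffBump.ae_convolution_tendsto_right_of_locallyIntegrable (μ := volume)
    (K := 2) hφ0 (Eventually.of_forall fun n => le_rfl) hwl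
  set F : ℕ → Pt → ℝ := fun n x => ∫ t, w t * (φ n).normed volume (x - t) with hF
  have hFc : ∀ n x, (convolution ((φ n).normed volume) w (ContinuousLinearMap.lsmul ℝ ℝ)
      volume) x = F n x := fun n x => by
    rw [convolution_lsmul_swap]
    exact integral_congr_ae (Eventually.of_forall fun t => by simp [mul_comm])
  have hconst : ∀ n, ∀ x ∈ Metric.ball x₀ r, ∀ y ∈ Metric.ball x₀ r, F n x = F n y := by
    intro n x hx y hy
    have hg : ContDiff ℝ ∞ ((φ n).normed (volume : Measure Pt)) := (φ n).contDiff_normed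
    have hcg := (φ n).hasCompactSupport_normed (μ := (volume : Measure Pt))
    have hd : ∀ x, HasFDerivAt (F n) ((convolution w (fderiv ℝ ((φ n).normed volume))
        ((ContinuousLinearMap.mul ℝ ℝ).precompR Pt) volume) x) x := fun x =>
      hcg.hasFDerivAt_convolution_right (ContinuousLinearMap.mul ℝ ℝ) hwl
        (hg.of_le (by simp)) x
    refine Convex.is_const_of_fderivWithin_eq_zero (𝕜 := ℝ) (convex_ball x₀ r)
      (fun x _ => (hd x).differentiableAt.differentiableWithinAt) (fun x hx => ?_) hx hy
    rw [fderivWithin_of_isOpen Metric.isOpen_ball hx, (hd x).fderiv]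
    ext a
    rw [convolution_precompR_apply (ContinuousLinearMap.mul ℝ ℝ) hwl (hcg.fderiv (𝕜 := ℝ))
      (hg.continuous_fderiv (by simp))]
    -- For fixed x in the ball, the reflected and translated mollifier is an admissible test
    -- function in the variable t; the room between r and 2r keeps its support inside U.
    have hη : ContDiff ℝ ∞ (fun t => (φ n).normed (volume : Measure Pt) (x - t)) :=
      hg.comp (contDiff_const.sub contDiff_id)
    have hηc : HasCompactSupport (fun t => (φ n).normed (volume : Measure Pt) (x - t)) :=
      hcg.comp_homeomorph (Homeomorph.subLeft x)
    have hηs : tsupport (fun t => (φ n).normed (volume : Measure Pt) (x - t)) ⊆ U := by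
      have h1 : tsupport (fun t => (φ n).normed (volume : Measure Pt) (x - t)) ⊆
          Metric.closedBall x (φ n).rOut := by
        refine closure_minimal (fun t ht => ?_) Metric.isClosed_closedBall
        have h2 : x - t ∈ Function.support ((φ n).normed (volume : Measure Pt)) := ht
        rw [ContDiffBump.support_normed_eq, mem_ball_zero_iff] at h2
        rw [Metric.mem_closedBall, dist_comm, dist_eq_norm]
        exact h2.le
      refine h1.trans (fun t ht => hsub ?_)
      rw [Metric.mem_closedBall] at ht
      rw [Metric.mem_ball] at hx ⊢
      linarith [dist_triangle t x x₀, hφr n]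
    have key := h _ hη hηc hηs a
    simp only [Pi.zero_apply, inner_zero_left, zero_mul, integral_zero, neg_zero] at key
    rw [convolution_def]
    have hfd : ∀ t, fderiv ℝ (fun t => (φ n).normed (volume : Measure Pt) (x - t)) t a =
        -(fderiv ℝ ((φ n).normed (volume : Measure Pt)) (x - t) a) := fun t => by
      exact fderiv_comp_sub_left (hg.differentiable (by simp)) x t a
    simp only [hfd] at key
    rw [← integral_indicator hU.measurableSet] at key
    have : ∫ t, (ContinuousLinearMap.mul ℝ ℝ) (w t)
        (fderiv ℝ ((φ n).normed (volume : Measure Pt)) (x - t) a) =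
        -∫ t, U.indicator (fun t => z t * -(fderiv ℝ ((φ n).normed (volume : Measure Pt))
          (x - t) a)) t := by
      rw [← integral_neg]
      refine integral_congr_ae (Eventually.of_forall fun t => ?_)
      by_cases ht : t ∈ U <;> simp [hw, ht]
    rw [this, key]
    simp
  -- A single point of convergence fixes the constant. If there is none, the almost-everywhere
  -- convergence already makes the claim vacuous.
  by_cases hex : ∃ y ∈ Metric.ball x₀ r, Tendsto (fun n => F n y) atTop (𝓝 (w y))
  · obtain ⟨y, hy, hyl⟩ := hex
    refine ⟨w y, ?_⟩
    filter_upwards [hlim] with x hx hxb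
    simp only [hFc] at hx
    have hxU : x ∈ U := hsub (Metric.ball_subset_ball (by linarith) hxb)
    have : w x = z x := indicator_of_mem hxU z
    rw [← this]
    refine tendsto_nhds_unique hx (hyl.congr fun n => hconst n y hy x hxb)
  · refine ⟨0, ?_⟩
    filter_upwards [hlim] with x hx hxb
    simp only [hFc] at hx
    exact absurd ⟨x, hxb, hx⟩ hex

/-- The local constants form a locally constant function of the centre of the ball; connectedness
makes it constant. -/
lemma ae_const_of_hasWeakGrad_zero {U : Set Pt} (hU : IsOpen U) (hc : IsPreconnected U)
    {z : Pt → ℝ} (hz : IntegrableOn z U) (h : HasWeakGrad U z 0) :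
    ∃ c, z =ᵐ[volume.restrict U] fun _ => c := by
  have hloc : ∀ x ∈ U, ∃ r > 0, ∃ c, ∀ᵐ y ∂volume, y ∈ Metric.ball x r → z y = c := by
    intro x hx
    obtain ⟨r, hr, hrU⟩ := Metric.isOpen_iff.mp hU x hx
    refine ⟨r / 2, by linarith, ae_const_ball_of_hasWeakGrad_zero hU hz h (by linarith) ?_⟩
    rwa [mul_div_cancel₀ _ two_ne_zero]
  choose! r hr c hcz using hloc
  -- Two overlapping balls meet in a nonempty open set, which has positive measure, so their
  -- constants agree.
  have hcc : ∀ x ∈ U, c =ᶠ[𝓝 x] fun _ => c x := by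
    intro x hx
    filter_upwards [hU.mem_nhds hx, Metric.ball_mem_nhds x (hr x hx)] with y hy hyx
    have hne : (Metric.ball x (r x) ∩ Metric.ball y (r y)).Nonempty :=
      ⟨y, hyx, Metric.mem_ball_self (hr y hy)⟩
    have hpos := (Metric.isOpen_ball.inter Metric.isOpen_ball).measure_pos
      (volume : Measure Pt) hne
    by_contra hcon
    refine hpos.ne' (measure_mono_null (fun t ht => ?_)
      (ae_iff.1 ((hcz x hx).and (hcz y hy))))
    intro hh
    exact hcon ((hh.2 ht.2).symm.trans (hh.1 ht.1))
  obtain ⟨a, ha⟩ := hU.exists_is_const_of_fderiv_eq_zero (𝕜 := ℝ) (f := c) hc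
    (fun x hx => ((hasFDerivAt_const (c x) x).congr_of_eventuallyEq
      (hcc x hx)).differentiableAt.differentiableWithinAt)
    (fun x hx => ((hasFDerivAt_const (c x) x).congr_of_eventuallyEq (hcc x hx)).fderiv)
  refine ⟨a, (ae_restrict_iff' hU.measurableSet).2 ?_⟩
  rw [ae_iff]
  -- Uncountably many balls are involved; a locally null set in a second countable space is null.
  refine measure_null_of_locally_null _ fun x hx => ?_
  have hxU : x ∈ U := by by_contra hcon; exact hx fun h => absurd h hcon
  refine ⟨_, inter_mem self_mem_nhdsWithin
    (mem_nhdsWithin_of_mem_nhds (Metric.ball_mem_nhds x (hr x hxU))), ?_⟩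
  refine measure_mono_null ?_ (ae_iff.1 (hcz x hxU))
  exact fun y hy hh => hy.1 fun _ => (hh hy.2).trans (ha x hxU)

/-! ### Traces -/

lemma injective_smul_sub_smul {d n : Pt} (hd : d ≠ 0) (hn : n ≠ 0) (h : ⟪d, n⟫ = 0) :
    Function.Injective fun q : ℝ × ℝ => q.1 • d - q.2 • n := by
  rintro ⟨s, t⟩ ⟨s', t'⟩ hq
  have h0 : (s - s') • d - (t - t') • n = 0 := by
    simp only at hq
    rw [sub_smul, sub_smul, sub_sub_sub_comm, hq, sub_self]
  have h1 := congrArg (fun y => ⟪d, y⟫) h0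
  have h2 := congrArg (fun y => ⟪n, y⟫) h0
  simp only [inner_sub_right, inner_smul_right, h, real_inner_comm d n, inner_zero_right,
    mul_zero, sub_zero, zero_sub, neg_eq_zero, mul_eq_zero, inner_self_eq_zero, hd, hn,
    or_false] at h1 h2
  exact Prod.ext (sub_eq_zero.1 h1) (sub_eq_zero.1 h2)

/-- Integration over a parallelogram that is contained in `U`. -/
lemma exists_lintegral_parallelogram_le {d n : Pt} (hd : d ≠ 0) (hn : n ≠ 0) (h : ⟪d, n⟫ = 0)
    (p : Pt) {U : Set Pt} (hU : MeasurableSet U) {I J : Set ℝ} (hI : MeasurableSet I)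
    (hJ : MeasurableSet J) (hsub : ∀ s ∈ I, ∀ t ∈ J, p + (s • d - t • n) ∈ U) :
    ∃ C : ℝ≥0∞, C ≠ ⊤ ∧ ∀ f : Pt → ℝ≥0∞, Measurable f →
      ∫⁻ s in I, ∫⁻ t in J, f (p + (s • d - t • n)) ≤ C * ∫⁻ x in U, f x := by
  let l : ℝ × ℝ →ₗ[ℝ] Pt :=
    (LinearMap.fst ℝ ℝ ℝ).smulRight d - (LinearMap.snd ℝ ℝ ℝ).smulRight n
  have hl : ∀ q, l q = q.1 • d - q.2 • n := fun q => rfl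
  let e : (ℝ × ℝ) ≃L[ℝ] Pt := (LinearEquiv.ofInjectiveOfFinrankEq l
    (injective_smul_sub_smul hd hn h) (by simp)).toContinuousLinearEquiv
  have he : ∀ q, e q = q.1 • d - q.2 • n := fun q => rfl
  -- The image of Lebesgue measure under a linear isomorphism is translation invariant, hence a
  -- multiple of Lebesgue measure. Only finiteness of the factor matters, so no determinant is
  -- computed.
  have hμ : ∃ c : NNReal, (volume : Measure (ℝ × ℝ)).map e = c • (volume : Measure Pt) :=
    ⟨_, Measure.isAddLeftInvariant_eq_smul _ _⟩
  obtain ⟨c, hc⟩ := hμ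
  refine ⟨c, ENNReal.coe_ne_top, fun f hf => ?_⟩
  have hm : Measurable fun q : ℝ × ℝ => f (p + (q.1 • d - q.2 • n)) :=
    hf.comp (by fun_prop)
  have hm' : Measurable fun y => U.indicator f (p + y) :=
    (hf.indicator hU).comp (by fun_prop)
  calc ∫⁻ s in I, ∫⁻ t in J, f (p + (s • d - t • n))
      = ∫⁻ q in I ×ˢ J, f (p + (q.1 • d - q.2 • n)) := by
        rw [Measure.volume_eq_prod, ← Measure.prod_restrict, lintegral_prod _ hm.aemeasurable]
    _ ≤ ∫⁻ q : ℝ × ℝ, U.indicator f (p + e q) := by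
        rw [← lintegral_indicator (hI.prod hJ)]
        refine lintegral_mono fun q => ?_
        by_cases hq : q ∈ I ×ˢ J
        · rw [indicator_of_mem hq, he, indicator_of_mem (hsub _ hq.1 _ hq.2)]
        · rw [indicator_of_notMem hq]; exact zero_le
    _ = ∫⁻ y, U.indicator f (p + y) ∂(volume : Measure (ℝ × ℝ)).map e := by
        rw [lintegral_map hm' e.continuous.measurable]
    _ = c * ∫⁻ x in U, f x := by
        rw [hc, lintegral_smul_measure, lintegral_add_left_eq_self, lintegral_indicator hU]
        rfl

/-- The fundamental theorem of calculus along the segment from `p` to `p - t • n`. The gradient is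
integrated over the full depth δ, so that its contribution no longer depends on t. -/
lemma enorm_le_add_lintegral {f : Pt → ℝ} (hf : ContDiff ℝ ∞ f) (p n : Pt) {t δ : ℝ}
    (ht : t ∈ Ioo 0 δ) :
    ‖f p‖ₑ ≤ ‖f (p - t • n)‖ₑ + ‖n‖ₑ * ∫⁻ τ in Ioo 0 δ, ‖∇ f (p - τ • n)‖ₑ := by
  have hγ : ∀ τ : ℝ, HasDerivAt (fun τ : ℝ => p - τ • n) (-n) τ := fun τ => by
    simpa using ((hasDerivAt_id τ).smul_const n).const_sub p
  have hd : ∀ τ, HasDerivAt (fun τ : ℝ => f (p - τ • n)) (-⟪∇ f (p - τ • n), n⟫) τ := fun τ => by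
    have h1 := (hf.differentiable (by simp) (p - τ • n)).hasFDerivAt.comp_hasDerivAt τ (hγ τ)
    rwa [map_neg, ← inner_gradient_left] at h1
  have hcont : Continuous fun τ : ℝ => -⟪∇ f (p - τ • n), n⟫ :=
    (((continuous_gradient hf).comp (by fun_prop)).inner continuous_const).neg
  have hint := intervalIntegral.integral_eq_sub_of_hasDerivAt (a := 0) (b := t)
    (fun τ _ => hd τ) (hcont.intervalIntegrable _ _)
  rw [zero_smul, sub_zero] at hint
  have h1 : f p = f (p - t • n) - ∫ τ in (0)..t, -⟪∇ f (p - τ • n), n⟫ := by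
    rw [hint]; ring
  calc ‖f p‖ₑ ≤ ‖f (p - t • n)‖ₑ + ‖∫ τ in (0)..t, -⟪∇ f (p - τ • n), n⟫‖ₑ := by
        conv_lhs => rw [h1]
        exact enorm_sub_le
    _ ≤ _ := by
        gcongr
        rw [intervalIntegral.integral_of_le ht.1.le,
          ← lintegral_const_mul' _ _ enorm_ne_top]
        refine (enorm_integral_le_lintegral_enorm _).trans ?_
        refine (lintegral_mono_set (Ioc_subset_Ioo_right ht.2)).trans
          (lintegral_mono fun τ => ?_)
        rw [enorm_neg, mul_comm, ← ofReal_norm, ← ofReal_norm, ← ofReal_norm,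
          ← ENNReal.ofReal_mul (norm_nonneg _)]
        exact ENNReal.ofReal_le_ofReal (norm_inner_le_norm _ _)

/-- The preceding bound integrated over the depth t. -/
lemma ofReal_mul_enorm_le {f : Pt → ℝ} (hf : ContDiff ℝ ∞ f) (p n : Pt) (δ : ℝ) :
    ENNReal.ofReal δ * ‖f p‖ₑ ≤ (∫⁻ t in Ioo 0 δ, ‖f (p - t • n)‖ₑ) +
      ENNReal.ofReal δ * ‖n‖ₑ * ∫⁻ t in Ioo 0 δ, ‖∇ f (p - t • n)‖ₑ := by
  have hm : Measurable fun t : ℝ => ‖f (p - t • n)‖ₑ :=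
    hf.continuous.measurable.enorm.comp (by fun_prop)
  have hc : ∀ c : ℝ≥0∞, ∫⁻ _ in Ioo 0 δ, c = ENNReal.ofReal δ * c := fun c => by
    rw [setLIntegral_const, Real.volume_Ioo, sub_zero, mul_comm]
  calc _ = ∫⁻ t in Ioo 0 δ, ‖f p‖ₑ := (hc _).symm
    _ ≤ ∫⁻ t in Ioo 0 δ,
          (‖f (p - t • n)‖ₑ + ‖n‖ₑ * ∫⁻ τ in Ioo 0 δ, ‖∇ f (p - τ • n)‖ₑ) :=
        setLIntegral_mono' measurableSet_Ioo fun t ht => enorm_le_add_lintegral hf p n ht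
    _ = _ := by rw [lintegral_add_left hm, hc, mul_assoc]

/-- A local trace inequality for smooth functions. -/
lemma exists_lintegral_side_le {d n : Pt} (hd : d ≠ 0) (hn : n ≠ 0) (h : ⟪d, n⟫ = 0)
    (p : Pt) {U : Set Pt} (hU : MeasurableSet U) {I : Set ℝ} (hI : MeasurableSet I) {δ : ℝ}
    (hδ : 0 < δ) (hsub : ∀ s ∈ I, ∀ t ∈ Ioo 0 δ, p + (s • d - t • n) ∈ U) :
    ∃ C : ℝ≥0∞, C ≠ ⊤ ∧ ∀ f : Pt → ℝ, ContDiff ℝ ∞ f →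
      ∫⁻ s in I, ‖f (p + s • d)‖ₑ ≤ C * ((∫⁻ x in U, ‖f x‖ₑ) + ∫⁻ x in U, ‖∇ f x‖ₑ) := by
  obtain ⟨C, hC, hCf⟩ := exists_lintegral_parallelogram_le hd hn h p hU hI measurableSet_Ioo hsub
  set D := ENNReal.ofReal δ with hD
  have hD0 : D ≠ 0 := (ENNReal.ofReal_pos.2 hδ).ne'
  have hDt : D ≠ ⊤ := ENNReal.ofReal_ne_top
  -- C comes from the change of variables and D⁻¹ from averaging over depth δ; the factor 1 + D‖n‖
  -- dominates both coefficients, 1 and D‖n‖.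
  refine ⟨D⁻¹ * ((1 + D * ‖n‖ₑ) * C), by finiteness, fun f hf => ?_⟩
  have hfm : Measurable fun x => ‖f x‖ₑ := hf.continuous.measurable.enorm
  have hgm : Measurable fun x => ‖∇ f x‖ₑ := (continuous_gradient hf).measurable.enorm
  have hm1 : Measurable fun q : ℝ × ℝ => ‖f (p + (q.1 • d - q.2 • n))‖ₑ := hfm.comp (by fun_prop)
  have hm2 : Measurable fun q : ℝ × ℝ => ‖∇ f (p + (q.1 • d - q.2 • n))‖ₑ :=
    hgm.comp (by fun_prop)
  have hs : ∀ s : ℝ, D * ‖f (p + s • d)‖ₑ ≤ (∫⁻ t in Ioo 0 δ, ‖f (p + (s • d - t • n))‖ₑ) +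
      D * ‖n‖ₑ * ∫⁻ t in Ioo 0 δ, ‖∇ f (p + (s • d - t • n))‖ₑ := by
    intro s
    simpa only [add_sub_assoc] using ofReal_mul_enorm_le hf (p + s • d) n δ
  calc ∫⁻ s in I, ‖f (p + s • d)‖ₑ = D⁻¹ * ∫⁻ s in I, D * ‖f (p + s • d)‖ₑ := by
        rw [lintegral_const_mul' _ _ hDt, ← mul_assoc, ENNReal.inv_mul_cancel hD0 hDt, one_mul]
    _ ≤ D⁻¹ * ∫⁻ s in I, ((∫⁻ t in Ioo 0 δ, ‖f (p + (s • d - t • n))‖ₑ) +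
          D * ‖n‖ₑ * ∫⁻ t in Ioo 0 δ, ‖∇ f (p + (s • d - t • n))‖ₑ) := by
        gcongr with s
        exact hs s
    _ = D⁻¹ * ((∫⁻ s in I, ∫⁻ t in Ioo 0 δ, ‖f (p + (s • d - t • n))‖ₑ) +
          D * ‖n‖ₑ * ∫⁻ s in I, ∫⁻ t in Ioo 0 δ, ‖∇ f (p + (s • d - t • n))‖ₑ) := by
        rw [lintegral_add_left, lintegral_const_mul']
        · finiteness
        · exact hm1.lintegral_prod_right'
    _ ≤ D⁻¹ * (C * (∫⁻ x in U, ‖f x‖ₑ) + D * ‖n‖ₑ * (C * ∫⁻ x in U, ‖∇ f x‖ₑ)) := by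
        gcongr
        · exact hCf _ hfm
        · exact hCf _ hgm
    _ ≤ D⁻¹ * ((1 + D * ‖n‖ₑ) * (C * (∫⁻ x in U, ‖f x‖ₑ)) +
          (1 + D * ‖n‖ₑ) * (C * ∫⁻ x in U, ‖∇ f x‖ₑ)) :=
        mul_le_mul_right (add_le_add (le_mul_of_one_le_left' le_self_add)
          (mul_le_mul_left le_add_self _)) _
    _ = _ := by ring

/-! ### Uniqueness of traces -/

lemma inner_rightNormal (a b : Pt) : ⟪b - a, rightNormal a b⟫ = 0 := by
  simp only [rightNormal, inner_smul_right]
  simp [PiLp.inner_apply, Fin.sum_univ_two]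
  right; ring

lemma rightNormal_ne_zero {a b : Pt} (h : a ≠ b) : rightNormal a b ≠ 0 := by
  intro h0
  have h1 : (!₂[b 1 - a 1, -(b 0 - a 0)] : Pt) = 0 :=
    (smul_eq_zero.1 h0).resolve_left (inv_ne_zero (dist_ne_zero.2 h))
  have h2 := congrFun (congrArg (fun x : Pt => (x : Fin 2 → ℝ)) h1) 0
  have h3 := congrFun (congrArg (fun x : Pt => (x : Fin 2 → ℝ)) h1) 1
  simp at h2 h3
  refine h ?_
  ext j
  fin_cases j
  · simp; linarith
  · simp; linarith

namespace SimplePolygon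

variable (K : SimplePolygon)

lemma fin_ne_add_one (i : Fin (K.m + 3)) : i ≠ i + 1 := by
  intro h
  have h1 : (1 : Fin (K.m + 3)) = 0 := by
    simpa using h.symm
  simpa using congrArg Fin.val h1

lemma v_ne (i : Fin (K.m + 3)) : K.v i ≠ K.v (i + 1) := fun h =>
  K.fin_ne_add_one i (K.v_injective h)

/-- The other edges form a closed set which, by simplicity, misses an interior point of this edge. A
small open rectangle on the inner side therefore avoids the whole boundary. It is connected and
meets the polygon by `outward`, so it lies in the polygon. -/
lemma exists_strip (i : Fin (K.m + 3)) {s₀ : ℝ} (hs₀ : s₀ ∈ Ioo (0 : ℝ) 1) :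
    ∃ δ > 0, Ioo (s₀ - δ) (s₀ + δ) ⊆ Ioo 0 1 ∧ ∀ s ∈ Ioo (s₀ - δ) (s₀ + δ), ∀ t ∈ Ioo 0 δ,
      K.v i + (s • (K.v (i + 1) - K.v i) - t • rightNormal (K.v i) (K.v (i + 1)))
        ∈ K.carrier := by
  set a := K.v i with ha
  set b := K.v (i + 1) with hb
  set n := rightNormal a b with hn
  have hab : a ≠ b := K.v_ne i
  have hn0 : n ≠ 0 := rightNormal_ne_zero hab
  have hline : ∀ s : ℝ, (AffineMap.lineMap a b s : Pt) = a + s • (b - a) := fun s => by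
    rw [AffineMap.lineMap_apply, vsub_eq_sub, vadd_eq_add, add_comm]
  set Φ : ℝ × ℝ → Pt := fun q => a + (q.1 • (b - a) - q.2 • n) with hΦ
  have hΦc : Continuous Φ := by fun_prop
  set R : Set Pt := ⋃ j ∈ {j | j ≠ i}, segment ℝ (K.v j) (K.v (j + 1)) with hR
  have hRc : IsClosed R := by
    refine (Set.toFinite _).isClosed_biUnion fun j _ => ?_
    rw [segment_eq_image_lineMap]
    exact (isCompact_Icc.image AffineMap.lineMap_continuous).isClosed
  have hx₀ : Φ (s₀, 0) ∉ R := by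
    intro hmem
    obtain ⟨j, hj, hjs⟩ := mem_iUnion₂.1 hmem
    have e : Φ (s₀, 0) = AffineMap.lineMap a b s₀ := by simp [hΦ, hline]
    have hseg : Φ (s₀, 0) ∈ segment ℝ a b := by
      rw [segment_eq_image_lineMap, e]
      exact ⟨s₀, Ioo_subset_Icc_self hs₀, rfl⟩
    have h1 := (K.simple i j (Ne.symm hj) ⟨hseg, hjs⟩).1
    rw [e] at h1
    rcases h1 with h1 | h1
    · rw [AffineMap.lineMap_eq_left_iff] at h1
      exact h1.elim hab hs₀.1.ne'
    · rw [mem_singleton_iff, AffineMap.lineMap_eq_right_iff] at h1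
      exact h1.elim hab hs₀.2.ne
  have hnh : Φ ⁻¹' Rᶜ ∈ 𝓝 (s₀, (0 : ℝ)) :=
    hΦc.continuousAt.preimage_mem_nhds (hRc.isOpen_compl.mem_nhds hx₀)
  obtain ⟨ε, hε, hεR⟩ := Metric.mem_nhds_iff.1 hnh
  -- The bound by ε keeps clear of the other edges, the other two keep the parameter s in (0, 1).
  -- The same δ serves as half-width and depth.
  set δ := min ε (min s₀ (1 - s₀)) with hδ
  have hδ0 : 0 < δ := lt_min hε (lt_min hs₀.1 (by linarith [hs₀.2]))
  have hδε : δ ≤ ε := min_le_left _ _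
  have hδ1 : δ ≤ s₀ := (min_le_right _ _).trans (min_le_left _ _)
  have hδ2 : δ ≤ 1 - s₀ := (min_le_right _ _).trans (min_le_right _ _)
  have hI : Ioo (s₀ - δ) (s₀ + δ) ⊆ Ioo 0 1 := fun s hs =>
    ⟨by linarith [hs.1], by linarith [hs.2]⟩
  refine ⟨δ, hδ0, hI, ?_⟩
  set B : Set (ℝ × ℝ) := Ioo (s₀ - δ) (s₀ + δ) ×ˢ Ioo 0 δ with hB
  have hpre : IsPreconnected (Φ '' B) :=
    (((convex_Ioo _ _).prod (convex_Ioo _ _)).isPreconnected).image _ hΦc.continuousOn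
  have hfr : ∀ q ∈ B, Φ q ∉ frontier K.carrier := by
    rintro ⟨s, t⟩ ⟨hs, ht⟩ hmem
    rw [K.frontier_eq] at hmem
    obtain ⟨j, hj⟩ := mem_iUnion.1 hmem
    -- On the line of the edge itself the normal coordinate is 0, whereas it is positive in the
    -- rectangle.
    by_cases hji : j = i
    · subst hji
      rw [segment_eq_image_lineMap] at hj
      obtain ⟨s', -, hs'⟩ := hj
      rw [hline] at hs'
      have h1 := injective_smul_sub_smul (sub_ne_zero.2 hab.symm) hn0 (inner_rightNormal a b)
        (a₁ := (s', 0)) (a₂ := (s, t)) (by simpa [hΦ] using hs')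
      exact ht.1.ne (congrArg Prod.snd h1)
    · have hball : (s, t) ∈ Metric.ball (s₀, (0 : ℝ)) ε := by
        rw [Metric.mem_ball, Prod.dist_eq, max_lt_iff, Real.dist_eq, Real.dist_eq, abs_lt, abs_lt]
        obtain ⟨hs1, hs2⟩ := hs
        obtain ⟨ht1, ht2⟩ := ht
        dsimp only at *
        constructor <;> constructor <;> linarith
      exact hεR hball (mem_iUnion₂.2 ⟨j, hji, hj⟩)
  have hmeet : (Φ '' B ∩ K.carrier).Nonempty := by
    have h1 := K.outward i s₀ hs₀
    have h2 : ∀ᶠ t in 𝓝[>] (0 : ℝ), t ∈ Ioo 0 δ := Ioo_mem_nhdsGT hδ0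
    obtain ⟨t, ⟨h3, -⟩, h4⟩ := (h1.and h2).exists
    refine ⟨Φ (s₀, t), ⟨_, ⟨⟨by simp [hδ0], by simp [hδ0]⟩, h4⟩, rfl⟩, ?_⟩
    rw [hline] at h3
    simpa [hΦ, add_sub_assoc] using h3
  -- Off the boundary the plane splits into two disjoint open sets, the polygon and the complement
  -- of its closure; a connected set lies in one of them.
  have hsub := hpre.subset_left_of_subset_union K.isOpen isClosed_closure.isOpen_compl
    (disjoint_compl_right.mono_left subset_closure) (by
      rintro _ ⟨q, hq, rfl⟩
      by_cases h : Φ q ∈ closure K.carrier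
      · left
        by_contra hcon
        refine hfr q hq ⟨h, ?_⟩
        rwa [K.isOpen.interior_eq]
      · exact Or.inr h) hmeet
  intro s hs t ht
  exact hsub ⟨(s, t), ⟨hs, ht⟩, rfl⟩

lemma edge_le_bdry (i : Fin (K.m + 3)) : K.edge i ≤ K.bdry := by
  rw [bdry, ← Finset.add_sum_erase _ _ (Finset.mem_univ i)]
  exact Measure.le_add_right le_rfl

lemma ae_edge_of_ae_bdry {P : Pt → Prop} (h : ∀ᵐ x ∂K.bdry, P x) (i : Fin (K.m + 3)) :
    ∀ᵐ x ∂K.edge i, P x := ae_mono (K.edge_le_bdry i) h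

end SimplePolygon

/-- For coinciding end points the arc measure is zero and carries no information about the
parameter. -/
lemma ae_lineMap_of_ae_arc {a b : Pt} (hab : a ≠ b) {P : Pt → Prop} (h : ∀ᵐ x ∂arc a b, P x) :
    ∀ᵐ s ∂volume.restrict (Icc (0 : ℝ) 1), P (AffineMap.lineMap a b s) := by
  unfold arc at h
  rw [Measure.ae_ennreal_smul_measure_iff
    (ENNReal.ofReal_pos.2 (dist_pos.2 hab)).ne'] at h
  exact ae_of_ae_map (measurable_lineMap a b).aemeasurable h

lemma lintegral_arc {a b : Pt} {f : Pt → ℝ≥0∞} (hf : Measurable f) :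
    ∫⁻ x, f x ∂arc a b =
      ENNReal.ofReal (dist a b) * ∫⁻ s in Icc (0 : ℝ) 1, f (AffineMap.lineMap a b s) := by
  rw [arc, lintegral_smul_measure, lintegral_map hf (measurable_lineMap a b)]
  rfl

/-- The Cauchy–Schwarz inequality against the constant 1. -/
lemma exists_lintegral_enorm_le {F : Type*} [NormedAddCommGroup F] (μ : Measure Pt)
    [IsFiniteMeasure μ] :
    ∃ C : ℝ≥0∞, C ≠ ⊤ ∧ ∀ w : Lp F 2 μ, ∫⁻ x, ‖w x‖ₑ ∂μ ≤ C * ‖w‖ₑ := by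
  refine ⟨μ univ ^ ((1 : ℝ) / 2), by finiteness, fun w => ?_⟩
  rw [← eLpNorm_one_eq_lintegral_enorm, Lp.enorm_def, mul_comm]
  convert eLpNorm_le_eLpNorm_mul_rpow_measure_univ (p := 1) (q := 2) (by norm_num)
    (Lp.aestronglyMeasurable w) using 3
  norm_num

/-- Approximate `w` by smooth triples. By the strip estimate their boundary values are controlled in
L¹ near the given point by the functions and gradients, which tend to zero; at the same time they
converge to the trace of `w`. -/
lemma tr_ae_eq_zero_local (K : SimplePolygon) (i : Fin (K.m + 3)) {w : Triple K}
    (hw : w ∈ (smoothTriples K).topologicalClosure) (h1 : w.1 = 0) (h2 : w.2.1 = 0)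
    {s₀ : ℝ} (hs₀ : s₀ ∈ Ioo (0 : ℝ) 1) :
    ∃ δ > 0, ∀ᵐ s ∂volume.restrict (Ioo (s₀ - δ) (s₀ + δ)),
      w.2.2 (AffineMap.lineMap (K.v i) (K.v (i + 1)) s) = 0 := by
  obtain ⟨δ, hδ, hI, hstrip⟩ := K.exists_strip i hs₀
  refine ⟨δ, hδ, ?_⟩
  set a := K.v i with ha
  set b := K.v (i + 1) with hb
  have hab : a ≠ b := K.v_ne i
  obtain ⟨C, hC, hCf⟩ := exists_lintegral_side_le (sub_ne_zero.2 hab.symm)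
    (rightNormal_ne_zero hab) (inner_rightNormal a b) a K.isOpen.measurableSet
    measurableSet_Ioo hδ hstrip
  obtain ⟨C₁, hC₁, hCf₁⟩ := exists_lintegral_enorm_le (F := ℝ) K.area
  obtain ⟨C₂, hC₂, hCf₂⟩ := exists_lintegral_enorm_le (F := Pt) K.area
  obtain ⟨C₃, hC₃, hCf₃⟩ := exists_lintegral_enorm_le (F := ℝ) K.bdry
  set D := ENNReal.ofReal (dist a b) with hD
  have hD0 : D ≠ 0 := (ENNReal.ofReal_pos.2 (dist_pos.2 hab)).ne'
  have hDt : D ≠ ⊤ := ENNReal.ofReal_ne_top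
  have hline : ∀ s : ℝ, (AffineMap.lineMap a b s : Pt) = a + s • (b - a) := fun s => by
    rw [AffineMap.lineMap_apply, vsub_eq_sub, vadd_eq_add, add_comm]
  set ν := volume.restrict (Ioo (s₀ - δ) (s₀ + δ)) with hν
  have hνle : ν ≤ volume.restrict (Icc (0 : ℝ) 1) :=
    Measure.restrict_mono (hI.trans Ioo_subset_Icc_self) le_rfl
  have hbd : ∀ g : Lp ℝ 2 K.bdry, ∫⁻ s, ‖g (AffineMap.lineMap a b s)‖ₑ ∂ν ≤
      D⁻¹ * (C₃ * ‖g‖ₑ) := fun g => by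
    have hgm : Measurable fun x => ‖g x‖ₑ := (Lp.stronglyMeasurable g).measurable.enorm
    calc _ ≤ ∫⁻ s in Icc (0 : ℝ) 1, ‖g (AffineMap.lineMap a b s)‖ₑ := lintegral_mono' hνle le_rfl
      _ = D⁻¹ * ∫⁻ x, ‖g x‖ₑ ∂K.edge i := by
        rw [SimplePolygon.edge, lintegral_arc hgm, ← mul_assoc, ENNReal.inv_mul_cancel hD0 hDt,
          one_mul]
      _ ≤ D⁻¹ * ∫⁻ x, ‖g x‖ₑ ∂K.bdry := by
        gcongr
        exact K.edge_le_bdry i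
      _ ≤ _ := by gcongr; exact hCf₃ g
  have hsm : ∀ w' ∈ smoothTriples K, ∫⁻ s, ‖w'.2.2 (AffineMap.lineMap a b s)‖ₑ ∂ν ≤
      C * (C₁ * ‖w'.1‖ₑ + C₂ * ‖w'.2.1‖ₑ) := by
    rintro w' ⟨f, hf, e1, e2, e3⟩
    have e4 : ∀ᵐ s ∂ν, w'.2.2 (AffineMap.lineMap a b s) = f (AffineMap.lineMap a b s) :=
      ae_mono hνle (ae_lineMap_of_ae_arc hab (K.ae_edge_of_ae_bdry e3 i))
    calc _ = ∫⁻ s, ‖f (a + s • (b - a))‖ₑ ∂ν :=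
          lintegral_congr_ae (e4.mono fun s hs => by rw [hs, hline])
      _ ≤ _ := hCf f hf
      _ = C * (∫⁻ x, ‖w'.1 x‖ₑ ∂K.area + ∫⁻ x, ‖w'.2.1 x‖ₑ ∂K.area) := by
          congr 2
          · exact lintegral_congr_ae (e1.mono fun x hx => congrArg _ hx.symm)
          · exact lintegral_congr_ae (e2.mono fun x hx => congrArg _ hx.symm)
      _ ≤ _ := by gcongr; exacts [hCf₁ _, hCf₂ _]
  -- The first summand accounts for the error in the trace component, the second for the boundary
  -- values of the smooth approximation.
  set E := D⁻¹ * C₃ + C * (C₁ + C₂) with hE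
  have hEt : E ≠ ⊤ := by
    have : D⁻¹ ≠ ⊤ := ENNReal.inv_ne_top.2 hD0
    finiteness
  have hle : ∀ w' ∈ smoothTriples K, ∫⁻ s, ‖w.2.2 (AffineMap.lineMap a b s)‖ₑ ∂ν ≤
      E * edist w' w := by
    intro w' hw'
    -- Because the first two components of `w` vanish, the norms of those of `w'` are bounded by the
    -- distance to `w`.
    have e1 : ‖w'.1‖ₑ ≤ edist w' w := by
      have : edist w'.1 w.1 ≤ edist w' w := le_max_left _ _
      rwa [h1, edist_zero_right] at this
    have e2' : edist w'.2 w.2 ≤ edist w' w := le_max_right _ _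
    have e2 : ‖w'.2.1‖ₑ ≤ edist w' w := by
      have : edist w'.2.1 w.2.1 ≤ edist w'.2 w.2 := le_max_left _ _
      rw [h2, edist_zero_right] at this
      exact this.trans e2'
    have e3 : ‖w.2.2 - w'.2.2‖ₑ ≤ edist w' w := by
      have : edist w'.2.2 w.2.2 ≤ edist w'.2 w.2 := le_max_right _ _
      rw [edist_comm, edist_eq_enorm_sub] at this
      exact this.trans e2'
    have e4 : ∀ᵐ s ∂ν, (w.2.2 - w'.2.2) (AffineMap.lineMap a b s) =
        w.2.2 (AffineMap.lineMap a b s) - w'.2.2 (AffineMap.lineMap a b s) :=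
      ae_mono hνle (ae_lineMap_of_ae_arc hab
      (K.ae_edge_of_ae_bdry (Lp.coeFn_sub w.2.2 w'.2.2) i))
    have hm : Measurable fun s : ℝ => ‖(w.2.2 - w'.2.2) (AffineMap.lineMap a b s : Pt)‖ₑ :=
      (Lp.stronglyMeasurable _).measurable.enorm.comp (measurable_lineMap a b)
    calc _ ≤ ∫⁻ s, (‖(w.2.2 - w'.2.2) (AffineMap.lineMap a b s : Pt)‖ₑ +
            ‖w'.2.2 (AffineMap.lineMap a b s)‖ₑ) ∂ν := by
          refine lintegral_mono_ae (e4.mono fun s hs => ?_)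
          rw [hs]
          simpa using enorm_add_le
            (w.2.2 (AffineMap.lineMap a b s) - w'.2.2 (AffineMap.lineMap a b s))
            (w'.2.2 (AffineMap.lineMap a b s))
      _ ≤ D⁻¹ * (C₃ * edist w' w) + C * (C₁ * edist w' w + C₂ * edist w' w) := by
          rw [lintegral_add_left hm]
          refine add_le_add ((hbd _).trans ?_) ((hsm w' hw').trans ?_)
          · gcongr
          · gcongr
      _ = _ := by rw [hE]; ring
  have h0 : ∫⁻ s, ‖w.2.2 (AffineMap.lineMap a b s)‖ₑ ∂ν = 0 := by
    obtain ⟨x, hx, hxl⟩ := mem_closure_iff_seq_limit.1 hw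
    have hlim : Tendsto (fun n => E * edist (x n) w) atTop (𝓝 (E * 0)) :=
      ENNReal.Tendsto.const_mul (tendsto_iff_edist_tendsto_0.1 hxl) (Or.inr hEt)
    rw [mul_zero] at hlim
    exact le_antisymm (ge_of_tendsto' hlim fun n => hle _ (hx n)) zero_le
  have hm : Measurable fun s : ℝ => ‖w.2.2 (AffineMap.lineMap a b s : Pt)‖ₑ :=
    (Lp.stronglyMeasurable _).measurable.enorm.comp (measurable_lineMap a b)
  filter_upwards [(lintegral_eq_zero_iff hm).1 h0] with s hs
  simpa using hs

/-- The trace is no additional freedom in a limit of smooth triples: it vanishes locally along the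
interior of each edge, and the end points are negligible. -/
lemma triple_eq_zero (K : SimplePolygon) {w : Triple K}
    (hw : w ∈ (smoothTriples K).topologicalClosure) (h1 : w.1 = 0) (h2 : w.2.1 = 0) :
    w = 0 := by
  refine Prod.ext h1 (Prod.ext h2 ?_)
  rw [Prod.snd_zero, Prod.snd_zero, Lp.eq_zero_iff_ae_eq_zero]
  have hm : MeasurableSet {x | w.2.2 x = (0 : Pt → ℝ) x} :=
    (Lp.stronglyMeasurable w.2.2).measurable (measurableSet_singleton 0)
  have hi : ∀ i, K.edge i {x | w.2.2 x = (0 : Pt → ℝ) x}ᶜ = 0 := by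
    intro i
    change ∀ᵐ x ∂K.edge i, w.2.2 x = (0 : Pt → ℝ) x
    rw [SimplePolygon.edge, arc]
    refine Measure.ae_smul_measure ((ae_map_iff (measurable_lineMap _ _).aemeasurable hm).2 ?_) _
    rw [← restrict_Ioo_eq_restrict_Icc, ae_restrict_iff' measurableSet_Ioo, ae_iff]
    refine measure_null_of_locally_null _ fun s hs => ?_
    have hs' : s ∈ Ioo (0 : ℝ) 1 := by by_contra hcon; exact hs fun h => absurd h hcon
    obtain ⟨δ, hδ, hae⟩ := tr_ae_eq_zero_local K i hw h1 h2 hs'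
    rw [ae_restrict_iff' measurableSet_Ioo, ae_iff] at hae
    refine ⟨_, inter_mem self_mem_nhdsWithin (mem_nhdsWithin_of_mem_nhds
      (Ioo_mem_nhds (sub_lt_self s hδ) (lt_add_of_pos_right s hδ))), measure_mono_null ?_ hae⟩
    exact fun y hy hh => hy.1 fun _ => hh hy.2
  have hsum : ∀ s, K.bdry s = ∑ i, K.edge i s := fun s => by
    rw [SimplePolygon.bdry, Measure.finsetSum_apply]
  exact (hsum _).trans (Finset.sum_eq_zero fun i _ => hi i)

/-! ### The elliptic projection -/

section

variable {K : SimplePolygon}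

@[simp] lemma fn_add (z w : H1 K) : fn (z + w) = fn z + fn w := rfl
@[simp] lemma fn_smul (r : ℝ) (z : H1 K) : fn (r • z) = r • fn z := rfl
@[simp] lemma fn_sub (z w : H1 K) : fn (z - w) = fn z - fn w := rfl
@[simp] lemma fn_zero : fn (0 : H1 K) = 0 := rfl
@[simp] lemma grad_add (z w : H1 K) : grad (z + w) = grad z + grad w := rfl
@[simp] lemma grad_smul (r : ℝ) (z : H1 K) : grad (r • z) = r • grad z := rfl
@[simp] lemma grad_sub (z w : H1 K) : grad (z - w) = grad z - grad w := rfl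
@[simp] lemma grad_zero : grad (0 : H1 K) = 0 := rfl
@[simp] lemma tr_add (z w : H1 K) : tr (z + w) = tr z + tr w := rfl
@[simp] lemma tr_smul (r : ℝ) (z : H1 K) : tr (r • z) = r • tr z := rfl

/-- Uniqueness of the trace, applied to the difference. -/
lemma H1.ext' {z w : H1 K} (h1 : fn z = fn w) (h2 : grad z = grad w) : z = w := by
  have h := triple_eq_zero K (z - w).2.2 (show fn (z - w) = 0 by rw [fn_sub, h1, sub_self])
    (show grad (z - w) = 0 by rw [grad_sub, h2, sub_self])
  exact sub_eq_zero.1 (Subtype.ext h)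

variable (K)

lemma fn_polyH1 (p : MvPolynomial (Fin 2) ℝ) : fn (polyH1 K p) =ᵐ[K.area] peval p :=
  MemLp.coeFn_toLp (memLp_of_continuous K (ae_area_mem K) (contDiff_peval p).continuous)

lemma grad_polyH1 (p : MvPolynomial (Fin 2) ℝ) : grad (polyH1 K p) =ᵐ[K.area] ∇ (peval p) :=
  MemLp.coeFn_toLp (memLp_of_continuous K (ae_area_mem K) (continuous_gradient (contDiff_peval p)))

lemma tr_polyH1 (p : MvPolynomial (Fin 2) ℝ) : tr (polyH1 K p) =ᵐ[K.bdry] peval p :=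
  MemLp.coeFn_toLp (memLp_of_continuous K (ae_bdry_mem K) (contDiff_peval p).continuous)

lemma polyH1_add (p q : MvPolynomial (Fin 2) ℝ) :
    polyH1 K (p + q) = polyH1 K p + polyH1 K q := by
  refine H1.ext' (Lp.ext ?_) (Lp.ext ?_)
  · filter_upwards [fn_polyH1 K (p + q), fn_polyH1 K p, fn_polyH1 K q,
      Lp.coeFn_add (fn (polyH1 K p)) (fn (polyH1 K q))] with x h1 h2 h3 h4
    rw [h1, fn_add, h4, Pi.add_apply, h2, h3, peval_add]
  · filter_upwards [grad_polyH1 K (p + q), grad_polyH1 K p, grad_polyH1 K q,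
      Lp.coeFn_add (grad (polyH1 K p)) (grad (polyH1 K q))] with x h1 h2 h3 h4
    rw [h1, grad_add, h4, Pi.add_apply, h2, h3, peval_add,
      gradient_add' (contDiff_peval _) (contDiff_peval _)]

lemma polyH1_smul (r : ℝ) (p : MvPolynomial (Fin 2) ℝ) :
    polyH1 K (r • p) = r • polyH1 K p := by
  refine H1.ext' (Lp.ext ?_) (Lp.ext ?_)
  · filter_upwards [fn_polyH1 K (r • p), fn_polyH1 K p,
      Lp.coeFn_smul r (fn (polyH1 K p))] with x h1 h2 h4
    rw [h1, fn_smul, h4, Pi.smul_apply, h2, peval_smul, smul_eq_mul]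
  · filter_upwards [grad_polyH1 K (r • p), grad_polyH1 K p,
      Lp.coeFn_smul r (grad (polyH1 K p))] with x h1 h2 h4
    rw [h1, grad_smul, h4, Pi.smul_apply, h2, peval_smul, gradient_smul' r (contDiff_peval _)]

/-- `polyH1` as a linear map. -/
def polyH1L : MvPolynomial (Fin 2) ℝ →ₗ[ℝ] H1 K where
  toFun := polyH1 K
  map_add' := polyH1_add K
  map_smul' := polyH1_smul K

variable {K}

/-- A function in `H¹(K)` with vanishing gradient is constant. -/
lemma exists_eq_polyH1_C {z : H1 K} (hz : grad z = 0) :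
    ∃ c, z = polyH1 K (MvPolynomial.C c) := by
  have hwg : HasWeakGrad K.carrier (fn z) 0 := by
    intro η hη hc hs a
    refine (z.2.1 η hη hc hs a).trans (congrArg Neg.neg (integral_congr_ae ?_))
    have h0 : grad z =ᵐ[K.area] 0 := by rw [hz]; exact Lp.coeFn_zero _ _ _
    filter_upwards [h0] with x hx
    exact congrArg (fun y => ⟪y, a⟫ * η x) hx
  obtain ⟨c, hc⟩ := ae_const_of_hasWeakGrad_zero K.isOpen K.isConnected.isPreconnected
    ((Lp.memLp (fn z)).integrable (by norm_num)) hwg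
  have hpe : peval (MvPolynomial.C c) = fun _ => c := by funext x; simp [peval]
  refine ⟨c, H1.ext' (Lp.ext ?_) (hz.trans (Lp.ext ?_))⟩
  · filter_upwards [hc, fn_polyH1 K (MvPolynomial.C c)] with x h1 h2
    rw [h1, h2, hpe]
  · filter_upwards [grad_polyH1 K (MvPolynomial.C c), Lp.coeFn_zero Pt 2 K.area] with x h1 h2
    rw [h1, h2, hpe]
    simp [gradient]

lemma inner_fn_polyH1 (f : Lp ℝ 2 K.area) (p : MvPolynomial (Fin 2) ℝ) :
    ⟪f, fn (polyH1 K p)⟫ = ∫ x, f x * peval p x ∂K.area := by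
  rw [L2.inner_def]
  refine integral_congr_ae ?_
  filter_upwards [fn_polyH1 K p] with x hx
  rw [hx]
  simp [mul_comm]

lemma inner_grad_polyH1 (f : Lp Pt 2 K.area) (p : MvPolynomial (Fin 2) ℝ) :
    ⟪f, grad (polyH1 K p)⟫ = ∫ x, ⟪f x, ∇ (peval p) x⟫ ∂K.area := by
  rw [L2.inner_def]
  refine integral_congr_ae ?_
  filter_upwards [grad_polyH1 K p] with x hx
  rw [hx]

/-- The defining conditions in terms of elements of L²; in this form they are visibly linear in the
pair of z and p. -/
lemma isEllProj_iff {k : ℕ} {z : H1 K} {p : MvPolynomial (Fin 2) ℝ} :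
    IsEllProj K k z p ↔ p ∈ Poly (k + 1) ∧
      (∀ q ∈ Poly (k + 1), ⟪grad (polyH1 K p), grad (polyH1 K q)⟫ = ⟪grad z, grad (polyH1 K q)⟫) ∧
      (k = 0 → ⨍ x, tr (polyH1 K p) x ∂K.bdry = ⨍ x, tr z x ∂K.bdry) ∧
      (1 ≤ k → ⨍ x, fn (polyH1 K p) x ∂K.area = ⨍ x, fn z x ∂K.area) := by
  have h1 : ⨍ x, tr (polyH1 K p) x ∂K.bdry = ⨍ x, peval p x ∂K.bdry :=
    average_congr (tr_polyH1 K p)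
  have h2 : ⨍ x, fn (polyH1 K p) x ∂K.area = ⨍ x, peval p x ∂K.area :=
    average_congr (fn_polyH1 K p)
  have h3 : ∀ q, ⟪grad (polyH1 K p), grad (polyH1 K q)⟫ =
      ∫ x, ⟪∇ (peval p) x, ∇ (peval q) x⟫ ∂K.area := fun q => by
    rw [inner_grad_polyH1]
    refine integral_congr_ae ?_
    filter_upwards [grad_polyH1 K p] with x hx
    rw [hx]
  simp only [h1, h2, h3, inner_grad_polyH1]
  rfl

lemma average_add_coeFn {μ : Measure Pt} [IsFiniteMeasure μ] (f g : Lp ℝ 2 μ) :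
    ⨍ x, (f + g) x ∂μ = ⨍ x, f x ∂μ + ⨍ x, g x ∂μ := by
  simp only [average_eq]
  rw [integral_congr_ae (Lp.coeFn_add f g), ← smul_add]
  congr 1
  exact integral_add ((Lp.memLp f).integrable (by norm_num)) ((Lp.memLp g).integrable (by norm_num))

lemma average_smul_coeFn {μ : Measure Pt} (r : ℝ) (f : Lp ℝ 2 μ) :
    ⨍ x, (r • f) x ∂μ = r * ⨍ x, f x ∂μ := by
  simp only [average_eq]
  rw [integral_congr_ae (Lp.coeFn_smul r f)]
  simp only [Pi.smul_apply, smul_eq_mul]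
  rw [integral_const_mul]
  ring

lemma IsEllProj.add {k : ℕ} {z w : H1 K} {p q : MvPolynomial (Fin 2) ℝ} (hp : IsEllProj K k z p)
    (hq : IsEllProj K k w q) : IsEllProj K k (z + w) (p + q) := by
  rw [isEllProj_iff] at *
  obtain ⟨p1, p2, p3, p4⟩ := hp
  obtain ⟨q1, q2, q3, q4⟩ := hq
  refine ⟨Submodule.add_mem _ p1 q1, fun r hr => ?_, fun h => ?_, fun h => ?_⟩
  · rw [polyH1_add, grad_add, grad_add, inner_add_left, inner_add_left, p2 r hr, q2 r hr]
  · rw [polyH1_add, tr_add, tr_add, average_add_coeFn, average_add_coeFn, p3 h, q3 h]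
  · rw [polyH1_add, fn_add, fn_add, average_add_coeFn, average_add_coeFn, p4 h, q4 h]

lemma IsEllProj.smul {k : ℕ} {z : H1 K} {p : MvPolynomial (Fin 2) ℝ} (r : ℝ)
    (hp : IsEllProj K k z p) : IsEllProj K k (r • z) (r • p) := by
  rw [isEllProj_iff] at *
  obtain ⟨p1, p2, p3, p4⟩ := hp
  refine ⟨Submodule.smul_mem _ r p1, fun q hq => ?_, fun h => ?_, fun h => ?_⟩
  · rw [polyH1_smul, grad_smul, grad_smul, real_inner_smul_left, real_inner_smul_left, p2 q hq]
  · rw [polyH1_smul, tr_smul, tr_smul, average_smul_coeFn, average_smul_coeFn, p3 h]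
  · rw [polyH1_smul, fn_smul, fn_smul, average_smul_coeFn, average_smul_coeFn, p4 h]

/-- Testing with p itself gives ∇p = 0, so p is constant. Its mean, over the boundary for k = 0 and
over the polygon otherwise, is zero. -/
lemma IsEllProj.polyH1_eq_zero {k : ℕ} {p : MvPolynomial (Fin 2) ℝ}
    (hp : IsEllProj K k 0 p) : polyH1 K p = 0 := by
  obtain ⟨h1, h2, h3, h4⟩ := isEllProj_iff.1 hp
  have h5 := h2 p h1
  rw [grad_zero, inner_zero_left, inner_self_eq_zero] at h5
  obtain ⟨c, hc⟩ := exists_eq_polyH1_C h5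
  have hpe : peval (MvPolynomial.C c) = fun _ => c := by funext x; simp [peval]
  have h0 : polyH1 K (MvPolynomial.C 0) = 0 := by rw [map_zero]; exact (polyH1L K).map_zero
  have hav : ∀ (μ : Measure Pt) [IsFiniteMeasure μ] [NeZero μ] (f : Pt → ℝ) (g : Lp ℝ 2 μ),
      f =ᵐ[μ] (fun _ => c) → g = 0 → ⨍ x, f x ∂μ = ⨍ x, g x ∂μ → c = 0 := by
    intro μ _ _ f g hf hg h
    rw [average_congr hf, average_const, hg, average_congr (Lp.coeFn_zero ℝ 2 μ)] at h
    simpa using h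
  have hc0 : c = 0 := by
    rw [hc] at h3 h4
    rcases Nat.eq_zero_or_pos k with hk | hk
    · refine hav K.bdry _ (tr (0 : H1 K)) ?_ rfl (h3 hk)
      rw [← hpe]
      exact tr_polyH1 K _
    · refine hav K.area _ (fn (0 : H1 K)) ?_ rfl (h4 hk)
      rw [← hpe]
      exact fn_polyH1 K _
  rw [hc, hc0, h0]

/-- The difference of two elliptic projections of z is an elliptic projection of 0. Consequently the
arbitrary choice in `ellProj` does not matter, and linearity follows. -/
lemma IsEllProj.ellProj_eq {k : ℕ} {z : H1 K} {p : MvPolynomial (Fin 2) ℝ}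
    (hp : IsEllProj K k z p) : ellProj K k z = polyH1 K p := by
  have h := ((exists_isEllProj K k z).choose_spec.add (hp.smul (-1)))
  have h0 : z + (-1 : ℝ) • z = 0 := by module
  have h' := (h0 ▸ h).polyH1_eq_zero
  rw [polyH1_add, polyH1_smul] at h'
  refine sub_eq_zero.1 (Eq.trans ?_ h')
  change polyH1 K _ - polyH1 K p = _
  module

lemma ellProj_add (k : ℕ) (z w : H1 K) :
    ellProj K k (z + w) = ellProj K k z + ellProj K k w := by
  rw [((exists_isEllProj K k z).choose_spec.add
    (exists_isEllProj K k w).choose_spec).ellProj_eq, polyH1_add]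
  rfl

lemma ellProj_smul (k : ℕ) (r : ℝ) (z : H1 K) : ellProj K k (r • z) = r • ellProj K k z := by
  rw [((exists_isEllProj K k z).choose_spec.smul r).ellProj_eq, polyH1_smul]
  rfl

variable (K) in
/-- The elliptic projection as a linear map. -/
def ellProjL (k : ℕ) : H1 K →ₗ[ℝ] H1 K where
  toFun := ellProj K k
  map_add' := ellProj_add k
  map_smul' := ellProj_smul k

/-! ### The local space is finite-dimensional -/

lemma integrable_peval_mul_tr (i : Fin (K.m + 3)) (p : MvPolynomial (Fin 2) ℝ) (w : H1 K) :
    Integrable (fun x => peval p x * tr w x) (K.edge i) :=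
  ((memLp_of_continuous K (ae_bdry_mem K) (contDiff_peval p).continuous).integrable_mul
    (Lp.memLp (tr w))).mono_measure (K.edge_le_bdry i)

variable (K)

/-- The functional `w ↦ (∇z, ∇w)`. -/
def gradPairing : H1 K →ₗ[ℝ] (H1 K → ℝ) where
  toFun z w := ⟪grad z, grad w⟫
  map_add' z z' := by funext w; simp [inner_add_left]
  map_smul' r z := by funext w; simp [real_inner_smul_left]

/-- The functional given by a Laplacian and normal derivatives. -/
def laplacianNormalPairing :
    (MvPolynomial (Fin 2) ℝ × (Fin (K.m + 3) → MvPolynomial (Fin 2) ℝ)) →ₗ[ℝ] (H1 K → ℝ) where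
  toFun f w := (∑ i, ∫ x, peval (f.2 i) x * tr w x ∂K.edge i) - ⟪fn w, fn (polyH1 K f.1)⟫
  map_add' f f' := by
    funext w
    simp only [Prod.snd_add, Prod.fst_add, Pi.add_apply, polyH1_add, fn_add, inner_add_right,
      peval_add, add_mul]
    rw [Finset.sum_congr rfl fun i _ => integral_add (integrable_peval_mul_tr i _ w)
      (integrable_peval_mul_tr i _ w), Finset.sum_add_distrib]
    ring
  map_smul' r f := by
    funext w
    simp only [Prod.smul_snd, Prod.smul_fst, Pi.smul_apply, polyH1_smul, fn_smul,
      real_inner_smul_right, peval_smul, mul_assoc, integral_const_mul, ← Finset.mul_sum,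
      RingHom.id_apply, smul_eq_mul]
    ring

variable {K}

/-- Green's identity read as an equality of two functionals, each linear in its data; this exhibits
the local condition as a preimage of a subspace. -/
lemma hasLaplacianNormal_iff {z : H1 K} {f : MvPolynomial (Fin 2) ℝ}
    {g : Fin (K.m + 3) → MvPolynomial (Fin 2) ℝ} :
    HasLaplacianNormal z f g ↔ laplacianNormalPairing K (f, g) = gradPairing K z := by
  have h1 : ∀ w, ⟪fn w, fn (polyH1 K f)⟫ = ∫ x, peval f x * fn w x ∂K.area := fun w => by
    rw [inner_fn_polyH1]; simp only [mul_comm]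
  have h2 : ∀ w : H1 K, ⟪grad z, grad w⟫ = ∫ x, ⟪grad z x, grad w x⟫ ∂K.area := fun w => rfl
  unfold HasLaplacianNormal
  rw [funext_iff]
  refine forall_congr' fun w => ?_
  rw [← h1, ← h2, eq_comm, ← sub_eq_iff_eq_add]
  rfl

variable (K)

/-- The functions in `H¹(K)` with polynomial Laplacian and normal derivatives. -/
def lapSpace (k : ℕ) : Submodule ℝ (H1 K) :=
  (((Poly (k + 1)).prod (Submodule.pi univ fun _ => Poly k)).map
    (laplacianNormalPairing K)).comap (gradPairing K)

lemma mem_lapSpace {k : ℕ} {z : H1 K} : z ∈ lapSpace K k ↔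
    ∃ f ∈ Poly (k + 1), ∃ g : Fin (K.m + 3) → MvPolynomial (Fin 2) ℝ,
      (∀ i, g i ∈ Poly k) ∧ HasLaplacianNormal z f g := by
  simp only [hasLaplacianNormal_iff, lapSpace, Submodule.mem_comap, Submodule.mem_map,
    Submodule.mem_prod, Submodule.mem_pi, Prod.exists, mem_univ, true_imp_iff]
  constructor
  · rintro ⟨f, g, ⟨hf, hg⟩, h⟩
    exact ⟨f, hf, g, hg, h⟩
  · rintro ⟨f, hf, g, hg, h⟩
    exact ⟨f, g, ⟨hf, hg⟩, h⟩

/-- A space is finitely generated if its image under a linear map and its part of the kernel are.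
The image under `gradPairing` lies in that of the finite-dimensional space of polynomial data, and
the kernel contains only constants. -/
lemma finiteDimensional_lapSpace (k : ℕ) : FiniteDimensional ℝ (lapSpace K k) := by
  refine Module.Finite.iff_fg.2 (Submodule.fg_of_fg_map_of_fg_inf_ker (gradPairing K) ?_ ?_)
  · have hP : ∀ r, (Poly r).FG := fun r => Module.Finite.iff_fg.1 inferInstance
    have hR := (((hP (k + 1)).prod (Submodule.fg_pi (ι := Fin (K.m + 3))
      (p := fun _ => Poly k) fun _ => hP k))).map (laplacianNormalPairing K)
    have := Module.Finite.iff_fg.2 hR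
    exact Module.Finite.iff_fg.1 (Submodule.finiteDimensional_of_le (Submodule.map_comap_le _ _))
  · have : FiniteDimensional ℝ (Submodule.span ℝ {polyH1 K 1}) :=
      FiniteDimensional.span_singleton ℝ _
    refine Module.Finite.iff_fg.1 (Submodule.finiteDimensional_of_le
      (S₂ := Submodule.span ℝ {polyH1 K 1}) ?_)
    rintro z ⟨-, hz⟩
    -- The functional of z vanishes, in particular at z itself.
    have h0 : ⟪grad z, grad z⟫ = 0 := congrFun (LinearMap.mem_ker.1 hz) z
    obtain ⟨c, rfl⟩ := exists_eq_polyH1_C (inner_self_eq_zero.1 h0)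
    refine Submodule.mem_span_singleton.2 ⟨c, ?_⟩
    rw [← polyH1_smul, MvPolynomial.smul_eq_C_mul, mul_one]

/-- The local virtual element space as a subspace. -/
def localZh (k : ℕ) : Submodule ℝ (H1 K) where
  carrier := LocalZh K k
  zero_mem' := by
    refine ⟨(mem_lapSpace K).1 (lapSpace K k).zero_mem, fun p _ _ => ?_⟩
    rw [← inner_fn_polyH1, ← inner_fn_polyH1, show ellProj K k 0 = 0 from (ellProjL K k).map_zero]
  add_mem' := by
    rintro z w ⟨hz1, hz2⟩ ⟨hw1, hw2⟩
    refine ⟨(mem_lapSpace K).1 ((lapSpace K k).add_mem ((mem_lapSpace K).2 hz1)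
      ((mem_lapSpace K).2 hw1)), fun p hp hq => ?_⟩
    have h1 := hz2 p hp hq
    have h2 := hw2 p hp hq
    rw [← inner_fn_polyH1, ← inner_fn_polyH1] at *
    rw [ellProj_add, fn_add, fn_add, inner_add_left, inner_add_left, h1, h2]
  smul_mem' := by
    rintro r z ⟨hz1, hz2⟩
    refine ⟨(mem_lapSpace K).1 ((lapSpace K k).smul_mem r ((mem_lapSpace K).2 hz1)),
      fun p hp hq => ?_⟩
    have h1 := hz2 p hp hq
    rw [← inner_fn_polyH1, ← inner_fn_polyH1] at *
    rw [ellProj_smul, fn_smul, fn_smul, real_inner_smul_left, real_inner_smul_left, h1]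

instance (k : ℕ) : FiniteDimensional ℝ (localZh K k) :=
  have := finiteDimensional_lapSpace K k
  Submodule.finiteDimensional_of_le fun _ hz => (mem_lapSpace K).2 hz.1

end

/-! ### Multiplication by bounded fields, and restriction of measures -/

section fields

variable {E F : Type*} [NormedAddCommGroup E] [NormedSpace ℝ E] [NormedAddCommGroup F]
  [NormedSpace ℝ F] {μ ν : Measure Pt}

/-- Application of a field of linear maps, as an operator between `L²` spaces. -/
def fieldMul (A : Pt → E →L[ℝ] F)
    (hA : ∀ g : Pt → E, MemLp g 2 μ → MemLp (fun x => A x (g x)) 2 μ) :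
    Lp E 2 μ →ₗ[ℝ] Lp F 2 μ where
  toFun g := (hA g (Lp.memLp g)).toLp _
  map_add' g h := by
    rw [← MemLp.toLp_add]
    refine MemLp.toLp_congr _ _ ?_
    filter_upwards [Lp.coeFn_add g h] with x hx
    rw [hx]
    exact map_add _ _ _
  map_smul' r g := by
    rw [RingHom.id_apply, ← MemLp.toLp_const_smul]
    refine MemLp.toLp_congr _ _ ?_
    filter_upwards [Lp.coeFn_smul r g] with x hx
    rw [hx]
    exact map_smul _ _ _

lemma coeFn_fieldMul (A : Pt → E →L[ℝ] F)
    (hA : ∀ g : Pt → E, MemLp g 2 μ → MemLp (fun x => A x (g x)) 2 μ) (g : Lp E 2 μ) :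
    fieldMul A hA g =ᵐ[μ] fun x => A x (g x) := MemLp.coeFn_toLp (hA g (Lp.memLp g))

/-- Passage to a smaller measure. -/
def lpMono (h : μ ≤ ν) : Lp E 2 ν →ₗ[ℝ] Lp E 2 μ where
  toFun g := ((Lp.memLp g).mono_measure h).toLp _
  map_add' g g' := by
    rw [← MemLp.toLp_add]
    exact MemLp.toLp_congr _ _ (ae_mono h (Lp.coeFn_add g g'))
  map_smul' r g := by
    rw [RingHom.id_apply, ← MemLp.toLp_const_smul]
    exact MemLp.toLp_congr _ _ (ae_mono h (Lp.coeFn_smul r g))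

lemma coeFn_lpMono (h : μ ≤ ν) (g : Lp E 2 ν) : lpMono h g =ᵐ[μ] g :=
  MemLp.coeFn_toLp ((Lp.memLp g).mono_measure h)

end fields

/-- Measurable coefficients that are bounded on the closure of the domain. -/
structure IsBoundedData (Ω : Set Pt) (C : Coeff) (u : Pt → Pt) : Prop where
  φ_measurable : Measurable C.φ
  u_measurable : Measurable u
  φ_bound : ∃ A, ∀ x ∈ closure Ω, |C.φ x| ≤ A
  u_bound : ∃ B, ∀ x ∈ closure Ω, ‖u x‖ ≤ B

/-! ### Pointwise bounds for the tensors E(u) and D(u). -/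

lemma dirTensor_apply (u v : Pt) : dirTensor u v = ((‖u‖ ^ 2)⁻¹ * ⟪u, v⟫) • u := by
  simp [dirTensor, smul_smul]

lemma inner_dirTensor_nonneg (u v : Pt) : 0 ≤ ⟪dirTensor u v, v⟫ := by
  rw [dirTensor_apply, real_inner_smul_left, mul_assoc]
  exact mul_nonneg (by positivity) (mul_self_nonneg _)

lemma inner_dirTensor_le (u v : Pt) : ⟪dirTensor u v, v⟫ ≤ ‖v‖ ^ 2 := by
  rw [dirTensor_apply, real_inner_smul_left, mul_assoc]
  -- With `0⁻¹ = 0` the tensor is zero at u = 0, and the bound is trivial there.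
  rcases eq_or_ne u 0 with rfl | hu
  · simp
  have hu' : 0 < ‖u‖ ^ 2 := by positivity
  rw [inv_mul_le_iff₀ hu', ← sq, ← mul_pow]
  exact sq_le_sq' (by linarith [neg_le_of_abs_le (abs_real_inner_le_norm u v)])
    (real_inner_le_norm u v)

lemma norm_dirTensor_apply_le (u v : Pt) : ‖dirTensor u v‖ ≤ ‖v‖ := by
  rw [dirTensor_apply, norm_smul, norm_mul, norm_inv, norm_pow, norm_norm]
  rcases eq_or_ne u 0 with rfl | hu
  · simp
  have hu' : 0 < ‖u‖ := norm_pos_iff.2 hu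
  calc (‖u‖ ^ 2)⁻¹ * ‖⟪u, v⟫‖ * ‖u‖ ≤ (‖u‖ ^ 2)⁻¹ * (‖u‖ * ‖v‖) * ‖u‖ := by
        gcongr; exact norm_inner_le_norm u v
    _ = ‖v‖ := by field_simp

lemma Coeff.D_apply (C : Coeff) (u : Pt → Pt) (x v : Pt) :
    C.D u x v = C.φ x • (C.dm • v + ‖u x‖ • (C.dl • dirTensor (u x) v +
      C.dt • (v - dirTensor (u x) v))) := rfl

lemma Coeff.norm_D_apply_le (C : Coeff) (u : Pt → Pt) (x v : Pt) :
    ‖C.D u x v‖ ≤ |C.φ x| * (|C.dm| + ‖u x‖ * (|C.dl| + 2 * |C.dt|)) * ‖v‖ := by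
  have h := norm_dirTensor_apply_le (u x) v
  rw [Coeff.D_apply, norm_smul, Real.norm_eq_abs, mul_assoc]
  gcongr
  calc _ ≤ ‖C.dm • v‖ + ‖‖u x‖ • (C.dl • dirTensor (u x) v +
          C.dt • (v - dirTensor (u x) v))‖ := norm_add_le _ _
    _ ≤ |C.dm| * ‖v‖ + ‖u x‖ * (|C.dl| * ‖v‖ + |C.dt| * (‖v‖ + ‖v‖)) := by
        rw [norm_smul, norm_smul, norm_norm, Real.norm_eq_abs]
        gcongr
        refine (norm_add_le _ _).trans ?_
        rw [norm_smul, norm_smul, Real.norm_eq_abs, Real.norm_eq_abs]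
        gcongr
        exact (norm_sub_le _ _).trans (by gcongr)
    _ = _ := by ring

/-- Since 0 ≤ E(u) ≤ I, both dispersive contributions are nonnegative and only molecular diffusion
is kept. -/
lemma Coeff.le_inner_D (C : Coeff) (u : Pt → Pt) (x v : Pt) (hφ : 0 ≤ C.φ x) (hdl : 0 ≤ C.dl)
    (hdt : 0 ≤ C.dt) : C.φ x * C.dm * ‖v‖ ^ 2 ≤ ⟪C.D u x v, v⟫ := by
  have h1 := inner_dirTensor_nonneg (u x) v
  have h2 := inner_dirTensor_le (u x) v
  rw [Coeff.D_apply]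
  simp only [real_inner_smul_left, inner_add_left, inner_sub_left, real_inner_self_eq_norm_sq]
  rw [mul_assoc]
  refine mul_le_mul_of_nonneg_left (le_add_of_nonneg_right ?_) hφ
  exact mul_nonneg (norm_nonneg _) (add_nonneg (mul_nonneg hdl h1)
    (mul_nonneg hdt (sub_nonneg.2 h2)))

/-! ### Square integrability of the coefficients applied to L² fields. -/

namespace IsBoundedData

variable {Ω : Set Pt} {C : Coeff} {u : Pt → Pt} {μ : Measure Pt}

/-- Joint measurability in the point and the vector is what allows the tensor to be applied to an
almost everywhere measurable field. -/
lemma measurable_D (h : IsBoundedData Ω C u) :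
    Measurable fun q : Pt × Pt => C.D u q.1 q.2 := by
  have h1 : Measurable fun q : Pt × Pt => C.φ q.1 := h.φ_measurable.comp measurable_fst
  have h2 : Measurable fun q : Pt × Pt => u q.1 := h.u_measurable.comp measurable_fst
  have h3 : Measurable fun q : Pt × Pt => dirTensor (u q.1) q.2 := by
    have h4 : Measurable fun q : Pt × Pt => (‖u q.1‖ ^ 2)⁻¹ * ⟪u q.1, q.2⟫ :=
      ((h2.norm.pow_const 2).inv).mul (h2.inner measurable_snd)
    simp only [dirTensor_apply]
    exact h4.smul h2
  have h4 : Measurable fun q : Pt × Pt => C.dl • dirTensor (u q.1) q.2 := h3.const_smul C.dl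
  have h5 : Measurable fun q : Pt × Pt => C.dt • (q.2 - dirTensor (u q.1) q.2) :=
    (measurable_snd.sub h3).const_smul C.dt
  have h6 : Measurable fun q : Pt × Pt => C.dm • q.2 := measurable_snd.const_smul C.dm
  have h7 : Measurable fun q : Pt × Pt => ‖u q.1‖ • (C.dl • dirTensor (u q.1) q.2 +
      C.dt • (q.2 - dirTensor (u q.1) q.2)) := h2.norm.smul (h4.add h5)
  exact h1.smul (h6.add h7)

/-- The measure is left general, so that the same statement serves elements and mesh edges, both
carried by the closure of Ω. -/
lemma memLp_D (h : IsBoundedData Ω C u) (hμ : ∀ᵐ x ∂μ, x ∈ closure Ω) (g : Pt → Pt)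
    (hg : MemLp g 2 μ) : MemLp (fun x => C.D u x (g x)) 2 μ := by
  obtain ⟨A, hA⟩ := h.φ_bound
  obtain ⟨B, hB⟩ := h.u_bound
  have hm := h.measurable_D
  refine MemLp.of_le_mul (c := A * (|C.dm| + B * (|C.dl| + 2 * |C.dt|))) hg
    (hm.comp_aemeasurable (aemeasurable_id.prodMk
      hg.aestronglyMeasurable.aemeasurable)).aestronglyMeasurable ?_
  filter_upwards [hμ] with x hx
  refine (C.norm_D_apply_le u x (g x)).trans ?_
  have h1 := hA x hx
  have h2 := hB x hx
  have h3 : 0 ≤ A := (abs_nonneg _).trans h1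
  gcongr

lemma memLp_inner (h : IsBoundedData Ω C u) (hμ : ∀ᵐ x ∂μ, x ∈ closure Ω) (g : Pt → Pt)
    (hg : MemLp g 2 μ) : MemLp (fun x => innerSL ℝ (u x) (g x)) 2 μ := by
  obtain ⟨B, hB⟩ := h.u_bound
  have hm : Measurable fun q : Pt × Pt => ⟪u q.1, q.2⟫ :=
    (h.u_measurable.comp measurable_fst).inner measurable_snd
  refine MemLp.of_le_mul (c := B) hg
    (hm.comp_aemeasurable (aemeasurable_id.prodMk
      hg.aestronglyMeasurable.aemeasurable)).aestronglyMeasurable ?_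
  filter_upwards [hμ] with x hx
  refine (norm_inner_le_norm (u x) (g x)).trans ?_
  have h2 := hB x hx
  gcongr

lemma memLp_inner_D (h : IsBoundedData Ω C u) (hμ : ∀ᵐ x ∂μ, x ∈ closure Ω) (n : Pt) (g : Pt → Pt)
    (hg : MemLp g 2 μ) : MemLp (fun x => (innerSL ℝ n ∘L C.D u x) (g x)) 2 μ :=
  (h.memLp_D hμ g hg).const_inner n

end IsBoundedData

/-! ### Jumps -/

/-- The reflection s ↦ 1 − s preserves the parameter measure. This is needed because neighbouring
elements traverse a common edge in opposite directions. -/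
lemma arc_comm (a b : Pt) : arc b a = arc a b := by
  have h : (volume.restrict (Icc (0 : ℝ) 1)).map (fun s => 1 - s) = volume.restrict (Icc 0 1) := by
    have h1 := (Measure.measurePreserving_sub_left (volume : Measure ℝ) 1).restrict_preimage
      (measurableSet_Icc (a := (0 : ℝ)) (b := 1))
    have h2 : (fun s : ℝ => 1 - s) ⁻¹' Icc 0 1 = Icc 0 1 := by
      ext s; simp
    rw [h2] at h1
    exact h1.map_eq
  unfold arc
  rw [dist_comm b a]
  congr 1
  conv_rhs => rw [← h]
  rw [Measure.map_map (measurable_lineMap a b) (by fun_prop)]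
  congr 1
  funext s
  simp [AffineMap.lineMap_apply_one_sub]

namespace Mesh

variable {Ω : Set Pt} (T : Mesh Ω)

lemma edge_le_bdry_left (e : T.ε) : T.edge e ≤ (T.elem (T.left e).1).bdry :=
  (T.elem (T.left e).1).edge_le_bdry _

lemma edge_le_bdry_right {e : T.ε} {s} (h : T.right e = some s) :
    T.edge e ≤ (T.elem s.1).bdry := by
  obtain ⟨h1, h2⟩ := T.right_matches e s h
  have h3 : T.edge e = (T.elem s.1).edge s.2 := by
    rw [edge, SimplePolygon.edge, SimplePolygon.edge, h1, h2, arc_comm]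
  rw [h3]
  exact (T.elem s.1).edge_le_bdry _

lemma area_le (K : T.ι) : (T.elem K).area ≤ volume.restrict Ω :=
  Measure.restrict_mono (T.subset K) le_rfl

lemma closure_subset (K : T.ι) : closure (T.elem K).carrier ⊆ closure Ω :=
  closure_mono (T.subset K)

lemma ae_area_mem (K : T.ι) : ∀ᵐ x ∂(T.elem K).area, x ∈ closure Ω :=
  (VEM.ae_area_mem _).mono fun _ hx => T.closure_subset K hx

lemma ae_edge_mem (e : T.ε) : ∀ᵐ x ∂T.edge e, x ∈ closure Ω :=
  ae_mono (T.edge_le_bdry_left e)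
    ((VEM.ae_bdry_mem _).mono fun _ hx => T.closure_subset _ hx)

lemma memLp_jump (bd : Bool) (z : T.BrokenH1) (e : T.ε) : MemLp (T.jump bd z e) 2 (T.edge e) := by
  have hl : MemLp (tr (z (T.left e).1)) 2 (T.edge e) :=
    (Lp.memLp _).mono_measure (T.edge_le_bdry_left e)
  cases h : T.right e with
  | some s =>
    have hj : T.jump bd z e = fun x => tr (z (T.left e).1) x - tr (z s.1) x := by
      funext x; simp [jump, h]
    rw [hj]
    exact hl.sub ((Lp.memLp _).mono_measure (T.edge_le_bdry_right h))
  | none =>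
    cases bd
    · have hj : T.jump false z e = fun _ => 0 := by funext x; simp [jump, h]
      rw [hj]
      exact MemLp.zero
    · have hj : T.jump true z e = tr (z (T.left e).1) := by funext x; simp [jump, h]
      rwa [hj]

/-- The jump across a mesh edge, as a linear map. -/
def jumpL (bd : Bool) (e : T.ε) : T.BrokenH1 →ₗ[ℝ] Lp ℝ 2 (T.edge e) where
  toFun z := (T.memLp_jump bd z e).toLp _
  map_add' z w := by
    rw [← MemLp.toLp_add]
    refine MemLp.toLp_congr _ _ ?_
    have hl := ae_mono (T.edge_le_bdry_left e)
      (Lp.coeFn_add (tr (z (T.left e).1)) (tr (w (T.left e).1)))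
    cases h : T.right e with
    | some s =>
      have hr := ae_mono (T.edge_le_bdry_right h) (Lp.coeFn_add (tr (z s.1)) (tr (w s.1)))
      filter_upwards [hl, hr] with x h1 h2
      simp only [jump, h, Pi.add_apply, tr_add, h1, h2]
      ring
    | none =>
      filter_upwards [hl] with x h1
      cases bd
      · simp [jump, h]
      · simp only [jump, h, Pi.add_apply, tr_add, h1, if_true]
  map_smul' r z := by
    rw [RingHom.id_apply, ← MemLp.toLp_const_smul]
    refine MemLp.toLp_congr _ _ ?_
    have hl := ae_mono (T.edge_le_bdry_left e) (Lp.coeFn_smul r (tr (z (T.left e).1)))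
    cases h : T.right e with
    | some s =>
      have hr := ae_mono (T.edge_le_bdry_right h) (Lp.coeFn_smul r (tr (z s.1)))
      filter_upwards [hl, hr] with x h1 h2
      simp only [jump, h, Pi.smul_apply, tr_smul, h1, h2, smul_eq_mul]
      ring
    | none =>
      filter_upwards [hl] with x h1
      cases bd
      · simp [jump, h]
      · simp only [jump, h, Pi.smul_apply, tr_smul, h1, if_true]

lemma coeFn_jumpL (bd : Bool) (e : T.ε) (z : T.BrokenH1) :
    T.jumpL bd e z =ᵐ[T.edge e] T.jump bd z e := MemLp.coeFn_toLp (T.memLp_jump bd z e)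

lemma memLp_peval_edge (e : T.ε) (q : MvPolynomial (Fin 2) ℝ) : MemLp (peval q) 2 (T.edge e) :=
  (memLp_of_continuous (T.elem (T.left e).1) (ae_bdry_mem _)
    (contDiff_peval q).continuous).mono_measure (T.edge_le_bdry_left e)

lemma integral_jump_mul (bd : Bool) (e : T.ε) (q : MvPolynomial (Fin 2) ℝ) (z : T.BrokenH1) :
    ∫ x, T.jump bd z e x * peval q x ∂T.edge e =
      ⟪(T.memLp_peval_edge e q).toLp _, T.jumpL bd e z⟫ := by
  rw [L2.inner_def]
  refine integral_congr_ae ?_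
  filter_upwards [T.coeFn_jumpL bd e z, MemLp.coeFn_toLp (T.memLp_peval_edge e q)] with x h1 h2
  rw [h1, h2]
  simp

/-- The global virtual element space as a subspace. -/
def zh (bd : Bool) (k : ℕ) : Submodule ℝ T.BrokenH1 where
  carrier := T.Zh bd k
  zero_mem' := by
    refine ⟨fun K => (localZh (T.elem K) k).zero_mem, fun e q _ => ?_⟩
    rw [integral_jump_mul, map_zero, inner_zero_right]
  add_mem' := by
    rintro z w ⟨hz1, hz2⟩ ⟨hw1, hw2⟩
    refine ⟨fun K => (localZh (T.elem K) k).add_mem (hz1 K) (hw1 K), fun e q hq => ?_⟩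
    have h1 := hz2 e q hq
    have h2 := hw2 e q hq
    rw [integral_jump_mul] at *
    rw [map_add, inner_add_right, h1, h2, add_zero]
  smul_mem' := by
    rintro r z ⟨hz1, hz2⟩
    refine ⟨fun K => (localZh (T.elem K) k).smul_mem r (hz1 K), fun e q hq => ?_⟩
    have h1 := hz2 e q hq
    rw [integral_jump_mul] at *
    rw [map_smul, inner_smul_right, h1, mul_zero]

/-- The product of the finitely many local spaces is already finite-dimensional, before the jump
conditions are imposed. -/
instance (bd : Bool) (k : ℕ) : FiniteDimensional ℝ (T.zh bd k) := by
  have h : (Submodule.pi univ fun K => localZh (T.elem K) k).FG :=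
    Submodule.fg_pi fun K => Module.Finite.iff_fg.1 inferInstance
  have := Module.Finite.iff_fg.2 h
  have hle : T.zh bd k ≤ Submodule.pi univ fun K => localZh (T.elem K) k := fun z hz K _ => hz.1 K
  exact Submodule.finiteDimensional_of_le hle

end Mesh

/-! ### Definite bilinear forms on finite-dimensional spaces -/

/-- The constant is the minimum of the quadratic form on the compact unit sphere; homogeneity
extends the bound to all vectors. -/
lemma exists_pos_mul_norm_sq_le {V : Type*} [NormedAddCommGroup V] [NormedSpace ℝ V]
    [FiniteDimensional ℝ V] (B : V →ₗ[ℝ] V →ₗ[ℝ] ℝ) (hB : ∀ z, z ≠ 0 → 0 < B z z) :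
    ∃ α > 0, ∀ z, α * ‖z‖ ^ 2 ≤ B z z := by
  have : ProperSpace V := FiniteDimensional.proper ℝ V
  let B' : V →L[ℝ] V →L[ℝ] ℝ := LinearMap.toContinuousLinearMap
    ((LinearMap.toContinuousLinearMap : (V →ₗ[ℝ] ℝ) ≃ₗ[ℝ] (V →L[ℝ] ℝ)).toLinearMap ∘ₗ B)
  have hc : Continuous fun z => B z z := by
    have : Continuous fun z => B' z z := by fun_prop
    exact this
  -- The sphere is empty exactly when the space is trivial, and then any constant works.
  rcases (Metric.sphere (0 : V) 1).eq_empty_or_nonempty with he | hne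
  · refine ⟨1, one_pos, fun z => ?_⟩
    have hz : z = 0 := by
      by_contra hz
      have : ‖z‖⁻¹ • z ∈ Metric.sphere (0 : V) 1 := by
        simp [norm_smul, norm_ne_zero_iff.2 hz]
      rw [he] at this
      exact this
    simp [hz]
  · obtain ⟨z₀, hz₀, hmin⟩ := (isCompact_sphere (0 : V) 1).exists_isMinOn hne hc.continuousOn
    have hz₀' : ‖z₀‖ = 1 := by simpa using hz₀
    refine ⟨B z₀ z₀, hB z₀ (fun h => by simp [h] at hz₀'), fun z => ?_⟩
    rcases eq_or_ne z 0 with rfl | hz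
    · simp
    have hn : ‖z‖ ≠ 0 := norm_ne_zero_iff.2 hz
    have h1 : B z₀ z₀ ≤ B (‖z‖⁻¹ • z) (‖z‖⁻¹ • z) := hmin (by simp [norm_smul, hn])
    simp only [map_smul, LinearMap.smul_apply, smul_eq_mul] at h1
    calc _ ≤ (‖z‖⁻¹ * (‖z‖⁻¹ * B z z)) * ‖z‖ ^ 2 := by gcongr
      _ = B z z := by field_simp

lemma exists_pos_mul_norm_sq_le_on {V : Type*} [NormedAddCommGroup V] [NormedSpace ℝ V]
    (W : Submodule ℝ V) [FiniteDimensional ℝ W] (B : V →ₗ[ℝ] V →ₗ[ℝ] ℝ)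
    (hB : ∀ z ∈ W, z ≠ 0 → 0 < B z z) : ∃ α > 0, ∀ z ∈ W, α * ‖z‖ ^ 2 ≤ B z z := by
  obtain ⟨α, hα, hle⟩ := exists_pos_mul_norm_sq_le (B.domRestrict₁₂ W W)
    (fun z hz => hB z z.2 fun h0 => hz (Subtype.ext h0))
  exact ⟨α, hα, fun z hz => hle ⟨z, hz⟩⟩

lemma exists_abs_le_mul_norm_on {V : Type*} [NormedAddCommGroup V] [NormedSpace ℝ V]
    (W : Submodule ℝ V) [FiniteDimensional ℝ W] (l : V →ₗ[ℝ] ℝ) :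
    ∃ A, 0 ≤ A ∧ ∀ z ∈ W, |l z| ≤ A * ‖z‖ := by
  let l' : W →L[ℝ] ℝ := LinearMap.toContinuousLinearMap (l.domRestrict W)
  exact ⟨‖l'‖, l'.opNorm_nonneg, fun z hz => l'.le_opNorm ⟨z, hz⟩⟩

/-! ### The forms are bilinear -/

/-- The part of a function that the elliptic projection annihilates. -/
def ellRes (K : SimplePolygon) (k : ℕ) : H1 K →ₗ[ℝ] H1 K := LinearMap.id - ellProjL K k

section forms

variable {Ω : Set Pt} (T : Mesh Ω) (k : ℕ) {C : Coeff} {u : Pt → Pt} (h : IsBoundedData Ω C u)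
  (S : (K : T.ι) → LinearMap.BilinForm ℝ (H1 (T.elem K))) (lam : ℝ) (bd : Bool)

/-- Multiplication by `D(u)` on an element. -/
def mulD (K : T.ι) : Lp Pt 2 (T.elem K).area →ₗ[ℝ] Lp Pt 2 (T.elem K).area :=
  fieldMul (C.D u) (h.memLp_D (T.ae_area_mem K))

/-- The inner product with `u` on an element. -/
def mulU (K : T.ι) : Lp Pt 2 (T.elem K).area →ₗ[ℝ] Lp ℝ 2 (T.elem K).area :=
  fieldMul (fun x => innerSL ℝ (u x)) (h.memLp_inner (T.ae_area_mem K))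

/-- The normal component of `D(u)` applied to a vector field on a mesh edge. -/
def mulDNormal (e : T.ε) : Lp Pt 2 (T.elem (T.left e).1).bdry →ₗ[ℝ] Lp ℝ 2 (T.edge e) :=
  fieldMul (fun x => innerSL ℝ (T.normal e) ∘L C.D u x)
    (h.memLp_inner_D (T.ae_edge_mem e) (T.normal e)) ∘ₗ lpMono (T.edge_le_bdry_left e)

variable {T}

lemma inner_mulD (K : T.ι) (f g : Lp Pt 2 (T.elem K).area) :
    ⟪mulD T h K f, g⟫ = ∫ x, ⟪C.D u x (f x), g x⟫ ∂(T.elem K).area := by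
  rw [L2.inner_def]
  refine integral_congr_ae ?_
  filter_upwards [coeFn_fieldMul (C.D u) (h.memLp_D (T.ae_area_mem K)) f] with x hx
  rw [mulD, hx]

lemma inner_mulU (K : T.ι) (f : Lp Pt 2 (T.elem K).area) (g : Lp ℝ 2 (T.elem K).area) :
    ⟪mulU T h K f, g⟫ = ∫ x, ⟪u x, f x⟫ * g x ∂(T.elem K).area := by
  rw [L2.inner_def]
  refine integral_congr_ae ?_
  filter_upwards [coeFn_fieldMul (fun x => innerSL ℝ (u x))
    (h.memLp_inner (T.ae_area_mem K)) f] with x hx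
  rw [mulU, hx]
  simp [mul_comm]

lemma inner_Lp_real {μ : Measure Pt} (f g : Lp ℝ 2 μ) : ⟪f, g⟫ = ∫ x, f x * g x ∂μ := by
  rw [L2.inner_def]
  simp [mul_comm]

/-- With every integral written as an inner product of linear images of c and z, bilinearity becomes
a matter of rewriting. `rhs_eq` plays the same part for the right-hand side. -/
lemma Γh_eq (c z : T.BrokenH1) : Γh T k C u S lam c z =
    (∑ K, ⟪mulD T h K (vproj (T.elem K) k (grad (c K))), vproj (T.elem K) k (grad (z K))⟫ +
      ∑ K, C.ν u (T.elem K) *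
        S K (ellRes (T.elem K) k (c K)) (ellRes (T.elem K) k (z K))) +
    ∑ K, ⟪mulU T h K (vproj (T.elem K) k (grad (c K))), proj (T.elem K) (k + 1) (fn (z K))⟫ +
    lam * ∑ K, ⟪proj (T.elem K) (k + 1) (fn (c K)), proj (T.elem K) (k + 1) (fn (z K))⟫ := by
  simp only [inner_mulD, inner_mulU]
  simp only [inner_Lp_real]
  rfl

lemma rhs_eq (c : H2 T) (z : T.BrokenH1) : rhs T C u lam bd c z =
    ∑ K, ⟪mulD T h K (lpMono (T.area_le K) c.1.2.1), grad (z K)⟫ +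
    ∑ K, ⟪mulU T h K (lpMono (T.area_le K) c.1.2.1), fn (z K)⟫ +
    lam * ∑ K, ⟪(lpMono (T.area_le K) c.1.1 : Lp ℝ 2 (T.elem K).area), fn (z K)⟫ -
    ∑ e, ⟪mulDNormal T h e (c.1.2.2 (T.left e).1), T.jumpL bd e z⟫ := by
  simp only [inner_mulD, inner_mulU]
  simp only [inner_Lp_real]
  unfold rhs Γpw Nh
  refine congrArg₂ (· - ·) (congrArg₂ (· + ·) (congrArg₂ (· + ·) ?_ ?_)
    (congrArg (lam * ·) ?_)) ?_ <;> refine Finset.sum_congr rfl fun K _ => integral_congr_ae ?_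
  · filter_upwards [coeFn_lpMono (T.area_le K) c.1.2.1] with x hx
    rw [hx]
  · filter_upwards [coeFn_lpMono (T.area_le K) c.1.2.1] with x hx
    rw [hx]
  · filter_upwards [coeFn_lpMono (T.area_le K) c.1.1] with x hx
    rw [hx]
  · filter_upwards [coeFn_lpMono (T.edge_le_bdry_left K) (c.1.2.2 (T.left K).1),
      T.coeFn_jumpL bd K z, coeFn_fieldMul _ (h.memLp_inner_D (T.ae_edge_mem K) (T.normal K))
        (lpMono (T.edge_le_bdry_left K) (c.1.2.2 (T.left K).1))] with x h1 h2 h3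
    rw [h2, mulDNormal, LinearMap.comp_apply, h3, h1]
    simp [real_inner_comm]

/-- The form `Γh` as a bilinear map. -/
def ΓhL : T.BrokenH1 →ₗ[ℝ] T.BrokenH1 →ₗ[ℝ] ℝ :=
  LinearMap.mk₂ ℝ (Γh T k C u S lam)
    (fun c c' z => by
      simp only [Γh_eq k h, Pi.add_apply, map_add, grad_add, fn_add, inner_add_left,
        LinearMap.add_apply, mul_add, Finset.sum_add_distrib]
      ring)
    (fun r c z => by
      simp only [Γh_eq k h, Pi.smul_apply, map_smul, grad_smul, fn_smul, real_inner_smul_left,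
        LinearMap.smul_apply, smul_eq_mul, mul_left_comm _ r, ← Finset.mul_sum]
      ring)
    (fun c z z' => by
      simp only [Γh_eq k h, Pi.add_apply, map_add, grad_add, fn_add, inner_add_right,
        mul_add, Finset.sum_add_distrib]
      ring)
    (fun r c z => by
      simp only [Γh_eq k h, Pi.smul_apply, map_smul, grad_smul, fn_smul, real_inner_smul_right,
        smul_eq_mul, mul_left_comm _ r, ← Finset.mul_sum]
      ring)

/-- The right-hand side as a bilinear map. -/
def rhsL : H2 T →ₗ[ℝ] T.BrokenH1 →ₗ[ℝ] ℝ :=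
  LinearMap.mk₂ ℝ (rhs T C u lam bd)
    (fun c c' z => by
      simp only [rhs_eq h, Submodule.coe_add, Prod.fst_add, Prod.snd_add, Pi.add_apply, map_add,
        inner_add_left, Finset.sum_add_distrib]
      ring)
    (fun r c z => by
      simp only [rhs_eq h, Submodule.coe_smul, Prod.smul_fst, Prod.smul_snd, Pi.smul_apply,
        map_smul, real_inner_smul_left, smul_eq_mul, ← Finset.mul_sum]
      ring)
    (fun c z z' => by
      simp only [rhs_eq h, Pi.add_apply, map_add, grad_add, fn_add, inner_add_right,
        Finset.sum_add_distrib]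
      ring)
    (fun r c z => by
      simp only [rhs_eq h, Pi.smul_apply, map_smul, grad_smul, fn_smul, real_inner_smul_right,
        smul_eq_mul, ← Finset.mul_sum]
      ring)

/-! ### The broken norm and the ambient norm of the product space. -/

variable (T) in
/-- The inner product of the broken space `H¹(𝒯)`. -/
def brokenInner : T.BrokenH1 →ₗ[ℝ] T.BrokenH1 →ₗ[ℝ] ℝ :=
  LinearMap.mk₂ ℝ (fun z w => ∑ K, (⟪fn (z K), fn (w K)⟫ + ⟪grad (z K), grad (w K)⟫))
    (fun c c' z => by
      simp only [Pi.add_apply, fn_add, grad_add, inner_add_left, Finset.sum_add_distrib]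
      ring)
    (fun r c z => by
      simp only [Pi.smul_apply, fn_smul, grad_smul, real_inner_smul_left, ← mul_add,
        ← Finset.mul_sum, smul_eq_mul])
    (fun c z z' => by
      simp only [Pi.add_apply, fn_add, grad_add, inner_add_right, Finset.sum_add_distrib]
      ring)
    (fun r c z => by
      simp only [Pi.smul_apply, fn_smul, grad_smul, real_inner_smul_right, ← mul_add,
        ← Finset.mul_sum, smul_eq_mul])

lemma brokenInner_self (z : T.BrokenH1) : brokenInner T z z = T.normSq z := by
  simp [brokenInner, Mesh.normSq]

lemma normSq_nonneg (z : T.BrokenH1) : 0 ≤ T.normSq z :=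
  Finset.sum_nonneg fun _ _ => by positivity

/-- The broken norm does not see traces; it is definite because function and gradient determine the
element. -/
lemma normSq_pos {z : T.BrokenH1} (hz : z ≠ 0) : 0 < T.normSq z := by
  refine (normSq_nonneg z).lt_of_ne' fun h0 => hz (funext fun K => ?_)
  have h1 := (Finset.sum_eq_zero_iff_of_nonneg fun _ _ => by positivity).1 h0 K (Finset.mem_univ K)
  have h2 : ‖fn (z K)‖ ^ 2 = 0 := by nlinarith [sq_nonneg ‖fn (z K)‖, sq_nonneg ‖grad (z K)‖]
  have h3 : ‖grad (z K)‖ ^ 2 = 0 := by nlinarith [sq_nonneg ‖fn (z K)‖, sq_nonneg ‖grad (z K)‖]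
  rw [sq_eq_zero_iff, norm_eq_zero] at h2 h3
  exact H1.ext' h2 h3

/-- The ambient norm is the maximum over elements and over all three stored components. Each of the
two components in the broken norm is bounded by it, whence the factor 2. -/
lemma normSq_le (z : T.BrokenH1) : T.normSq z ≤ (2 * Fintype.card T.ι) * ‖z‖ ^ 2 := by
  have h1 : ∀ K, ‖fn (z K)‖ ^ 2 + ‖grad (z K)‖ ^ 2 ≤ 2 * ‖z‖ ^ 2 := fun K => by
    have e0 : ‖z K‖ ≤ ‖z‖ := norm_le_pi_norm z K
    have e1 : ‖fn (z K)‖ ≤ ‖z K‖ := norm_fst_le (z K).1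
    have e2 : ‖grad (z K)‖ ≤ ‖z K‖ := (norm_fst_le (z K).1.2).trans (norm_snd_le (z K).1)
    have e3 : ‖fn (z K)‖ ^ 2 ≤ ‖z‖ ^ 2 := by gcongr; exact e1.trans e0
    have e4 : ‖grad (z K)‖ ^ 2 ≤ ‖z‖ ^ 2 := by gcongr; exact e2.trans e0
    linarith
  refine (Finset.sum_le_sum fun K _ => h1 K).trans ?_
  rw [Finset.sum_const, Finset.card_univ, nsmul_eq_mul]
  exact le_of_eq (by ring)

end forms

/-! ### Gradients of polynomials -/

lemma pderiv_mem_Poly {k : ℕ} {p : MvPolynomial (Fin 2) ℝ} (hp : p ∈ Poly (k + 1)) (i : Fin 2) :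
    MvPolynomial.pderiv i p ∈ Poly k := by
  rw [MvPolynomial.mem_restrictTotalDegree] at hp
  rw [p.as_sum, map_sum]
  refine Submodule.sum_mem _ fun s hs => ?_
  rw [MvPolynomial.pderiv_monomial, MvPolynomial.mem_restrictTotalDegree]
  -- Truncated subtraction would not lower the degree if the variable is absent, but then the
  -- coefficient of the derivative is zero.
  rcases Nat.eq_zero_or_pos (s i) with h0 | h0
  · simp [h0]
  have h1 : s.degree ≤ k + 1 := (MvPolynomial.le_totalDegree hs).trans hp
  have h2 : s - Finsupp.single i 1 + Finsupp.single i 1 = s :=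
    tsub_add_cancel_of_le (Finsupp.single_le_iff.2 h0)
  have h3 : (s - Finsupp.single i 1).degree + 1 = s.degree := by
    conv_rhs => rw [← h2, map_add, Finsupp.degree_single]
  refine (MvPolynomial.totalDegree_monomial_le _ _).trans ?_
  change (s - Finsupp.single i 1).degree ≤ k
  omega

lemma fderiv_peval_single (p : MvPolynomial (Fin 2) ℝ) (x : Pt) (i : Fin 2) :
    fderiv ℝ (peval p) x (EuclideanSpace.single i 1) = peval (MvPolynomial.pderiv i p) x := by
  have hd : ∀ q, DifferentiableAt ℝ (peval q) x := fun q =>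
    (contDiff_peval q).differentiable (by simp) x
  induction p using MvPolynomial.induction_on with
  | C a =>
    have h : peval (MvPolynomial.C a) = fun _ => a := by funext y; simp [peval]
    rw [h]
    simp [peval]
  | add p q hp hq =>
    rw [peval_add, fderiv_fun_add (hd p) (hd q), map_add, peval_add]
    exact congrArg₂ (· + ·) hp hq
  | mul_X p j hp =>
    have h : peval (p * MvPolynomial.X j) = fun y => peval p y * y j := by
      funext y; simp [peval]
    have hj : HasFDerivAt (fun y : Pt => y j) (EuclideanSpace.proj j : Pt →L[ℝ] ℝ) x :=
      (EuclideanSpace.proj j : Pt →L[ℝ] ℝ).hasFDerivAt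
    have hm : HasFDerivAt (fun y : Pt => peval p y * y j) _ x := (hd p).hasFDerivAt.mul hj
    rw [h, hm.fderiv]
    have e : (peval p x • (EuclideanSpace.proj j : Pt →L[ℝ] ℝ) + x j • fderiv ℝ (peval p) x)
        (EuclideanSpace.single i 1) = peval p x * (if j = i then 1 else 0) +
          x j * peval (MvPolynomial.pderiv i p) x := by
      rw [← hp]
      simp [PiLp.single_apply]
    rw [e]
    by_cases hij : j = i
    · subst hij; simp [peval]
    · simp [peval, hij, MvPolynomial.pderiv_X_of_ne hij]

lemma gradient_peval (p : MvPolynomial (Fin 2) ℝ) :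
    ∇ (peval p) = vpeval fun i => MvPolynomial.pderiv i p := by
  funext x
  ext i
  have h := inner_gradient_left (𝕜 := ℝ) (f := peval p) (x := x) (y := EuclideanSpace.single i 1)
  rw [fderiv_peval_single, EuclideanSpace.inner_single_right] at h
  simpa [vpeval] using h

/-- Differentiation lowers the degree from k + 1 to k, the degree onto which `vproj` projects. -/
lemma vproj_grad_polyH1 (K : SimplePolygon) {k : ℕ} {p : MvPolynomial (Fin 2) ℝ}
    (hp : p ∈ Poly (k + 1)) : vproj K k (grad (polyH1 K p)) = grad (polyH1 K p) := by
  refine Submodule.starProjection_eq_self_iff.2 ⟨fun i => ⟨_, pderiv_mem_Poly hp i⟩, ?_⟩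
  refine MemLp.toLp_congr (memLp_of_continuous K (ae_area_mem K) (continuous_vpeval _))
    (memLp_of_continuous K (ae_area_mem K) (continuous_gradient (contDiff_peval p))) ?_
  rw [gradient_peval]

lemma proj_fn_polyH1 (K : SimplePolygon) {r : ℕ} {p : MvPolynomial (Fin 2) ℝ}
    (hp : p ∈ Poly r) : proj K r (fn (polyH1 K p)) = fn (polyH1 K p) :=
  Submodule.starProjection_eq_self_iff.2 ⟨⟨p, hp⟩, rfl⟩

/-- By `h3` the gradient of z is that of a polynomial of degree at most k + 1, so it equals its own
projection, which is 0. Hence z is a constant, also fixed by its projection. -/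
lemma eq_zero_of_projections_eq_zero {K : SimplePolygon} {k : ℕ} {z : H1 K}
    (h1 : vproj K k (grad z) = 0) (h2 : proj K (k + 1) (fn z) = 0)
    (h3 : grad (z - ellProj K k z) = 0) : z = 0 := by
  have h4 : grad z = grad (ellProj K k z) := sub_eq_zero.1 h3
  have h5 : grad z = 0 := by
    rw [← h1, h4]
    exact (vproj_grad_polyH1 K (exists_isEllProj K k z).choose_spec.1).symm
  obtain ⟨c, hc⟩ := exists_eq_polyH1_C h5
  refine H1.ext' ?_ h5
  rw [fn_zero, ← h2, hc, proj_fn_polyH1]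
  rw [MvPolynomial.mem_restrictTotalDegree]
  simp

/-! ### Definiteness -/

section definite

variable {Ω : Set Pt} {T : Mesh Ω} {C : Coeff} {u : Pt → Pt}

lemma le_inner_mulD (h : IsBoundedData Ω C u)
    {φlo : ℝ} (hφ : ∀ x ∈ closure Ω, φlo ≤ C.φ x) (hφlo : 0 ≤ φlo)
    (hdm : 0 ≤ C.dm) (hdl : 0 ≤ C.dl) (hdt : 0 ≤ C.dt) (K : T.ι) (a : Lp Pt 2 (T.elem K).area) :
    φlo * C.dm * ‖a‖ ^ 2 ≤ ⟪mulD T h K a, a⟫ := by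
  rw [← real_inner_self_eq_norm_sq, L2.inner_def, L2.inner_def, ← integral_const_mul]
  refine integral_mono_ae ((L2.integrable_inner a a).const_mul _) (L2.integrable_inner _ _) ?_
  filter_upwards [coeFn_fieldMul (C.D u) (h.memLp_D (T.ae_area_mem K)) a, T.ae_area_mem K]
    with x hx hxΩ
  rw [mulD, hx, real_inner_self_eq_norm_sq]
  refine le_trans ?_ (C.le_inner_D u x (a x) (hφlo.trans (hφ x hxΩ)) hdl hdt)
  gcongr
  exact hφ x hxΩ

lemma norm_mulU_le (h : IsBoundedData Ω C u)
    {M : ℝ} (hM : ∀ᵐ x ∂volume.restrict Ω, ‖u x‖ ≤ M) (K : T.ι)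
    (a : Lp Pt 2 (T.elem K).area) : ‖mulU T h K a‖ ≤ M * ‖a‖ := by
  refine Lp.norm_le_mul_norm_of_ae_le_mul ?_
  filter_upwards [coeFn_fieldMul (fun x => innerSL ℝ (u x)) (h.memLp_inner (T.ae_area_mem K)) a,
    ae_mono (T.area_le K) hM] with x hx hxM
  rw [mulU, hx]
  refine (norm_inner_le_norm (u x) (a x)).trans ?_
  gcongr

/-- Young's inequality. The term M²/(2c) in the lower bound on λ pays for convection; the additional
1 leaves ‖b‖². -/
lemma le_element_form (h : IsBoundedData Ω C u)
    {φlo M lam : ℝ} (hφ : ∀ x ∈ closure Ω, φlo ≤ C.φ x) (hφlo : 0 < φlo)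
    (hdm : 0 < C.dm) (hdl : 0 ≤ C.dl) (hdt : 0 ≤ C.dt)
    (hM : ∀ᵐ x ∂volume.restrict Ω, ‖u x‖ ≤ M) (hlam : M ^ 2 / (2 * (φlo * C.dm)) + 1 ≤ lam)
    (K : T.ι) (a : Lp Pt 2 (T.elem K).area) (b : Lp ℝ 2 (T.elem K).area) :
    φlo * C.dm / 2 * ‖a‖ ^ 2 + ‖b‖ ^ 2 ≤
      ⟪mulD T h K a, a⟫ + ⟪mulU T h K a, b⟫ + lam * ⟪b, b⟫ := by
  have h1 := le_inner_mulD h hφ hφlo.le hdm.le hdl hdt K a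
  have h2 : -(M * ‖a‖ * ‖b‖) ≤ ⟪mulU T h K a, b⟫ := by
    have h3 := (abs_real_inner_le_norm (mulU T h K a) b).trans
      (mul_le_mul_of_nonneg_right (norm_mulU_le h hM K a) (norm_nonneg b))
    exact neg_le_of_abs_le h3
  have hc : 0 < φlo * C.dm := mul_pos hφlo hdm
  set c := φlo * C.dm
  rw [real_inner_self_eq_norm_sq]
  have h3 : (M ^ 2 / (2 * c) + 1) * ‖b‖ ^ 2 ≤ lam * ‖b‖ ^ 2 := by gcongr
  -- The completed square whose expansion is Young's inequality with exactly the weights needed.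
  have h4 : 0 ≤ (c * ‖a‖ - M * ‖b‖) ^ 2 / (2 * c) := by positivity
  have h5 : (c * ‖a‖ - M * ‖b‖) ^ 2 / (2 * c) =
      c / 2 * ‖a‖ ^ 2 - M * ‖a‖ * ‖b‖ + M ^ 2 / (2 * c) * ‖b‖ ^ 2 := by
    field_simp
    ring
  linarith

/-- The mean of the porosity inherits the pointwise lower bound. -/
lemma ν_pos (h : IsBoundedData Ω C u)
    {φlo : ℝ} (hφ : ∀ x ∈ closure Ω, φlo ≤ C.φ x) (hφlo : 0 < φlo)
    (hdm : 0 < C.dm) (hdt : 0 ≤ C.dt) (K : T.ι) : 0 < C.ν u (T.elem K) := by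
  obtain ⟨A, hA⟩ := h.φ_bound
  have hi : Integrable C.φ (T.elem K).area :=
    Integrable.of_bound h.φ_measurable.aestronglyMeasurable A
      ((T.ae_area_mem K).mono fun x hx => hA x hx)
  have h1 : φlo ≤ ⨍ x, C.φ x ∂(T.elem K).area := by
    conv_lhs => rw [← average_const (T.elem K).area φlo]
    rw [average_eq, average_eq]
    exact smul_le_smul_of_nonneg_left (integral_mono_ae (integrable_const _) hi
      ((T.ae_area_mem K).mono fun x hx => hφ x hx)) (by positivity)
  exact mul_pos (abs_pos.2 (hφlo.trans_le h1).ne') (by positivity)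

lemma Γh_self_pos (h : IsBoundedData Ω C u)
    {φlo M lam : ℝ} (hφ : ∀ x ∈ closure Ω, φlo ≤ C.φ x) (hφlo : 0 < φlo)
    (hdm : 0 < C.dm) (hdl : 0 ≤ C.dl) (hdt : 0 ≤ C.dt)
    (hM : ∀ᵐ x ∂volume.restrict Ω, ‖u x‖ ≤ M) (hlam : M ^ 2 / (2 * (φlo * C.dm)) + 1 ≤ lam)
    {k : ℕ} {S : (K : T.ι) → LinearMap.BilinForm ℝ (H1 (T.elem K))} {M₀ M₁ : ℝ} (hM₀ : 0 < M₀)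
    (hS : ∀ K, IsStabilization (T.elem K) k (S K) M₀ M₁) {bd : Bool} {z : T.BrokenH1}
    (hz : z ∈ T.Zh bd k) (hz0 : z ≠ 0) : 0 < Γh T k C u S lam z z := by
  set a := fun K => vproj (T.elem K) k (grad (z K))
  set b := fun K => proj (T.elem K) (k + 1) (fn (z K))
  set r := fun K => grad (z K - ellProj (T.elem K) k (z K))
  have hν := fun K : T.ι => ν_pos h hφ hφlo hdm hdt K
  have hc : 0 < φlo * C.dm := mul_pos hφlo hdm
  have hle : ∑ K, (φlo * C.dm / 2 * ‖a K‖ ^ 2 + ‖b K‖ ^ 2 +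
      C.ν u (T.elem K) * (M₀ * ‖r K‖ ^ 2)) ≤ Γh T k C u S lam z z := by
    rw [Γh_eq k h, Finset.mul_sum, ← Finset.sum_add_distrib, ← Finset.sum_add_distrib,
      ← Finset.sum_add_distrib]
    refine Finset.sum_le_sum fun K _ => ?_
    have h1 := le_element_form h hφ hφlo hdm hdl hdt hM hlam K (a K) (b K)
    have h2 := mul_le_mul_of_nonneg_left ((hS K).lower (z K) (hz.1 K)) (hν K).le
    change _ * _ ≤ _ * S K (ellRes (T.elem K) k (z K)) (ellRes (T.elem K) k (z K)) at h2
    linarith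
  have hnn : ∀ K, 0 ≤ φlo * C.dm / 2 * ‖a K‖ ^ 2 + ‖b K‖ ^ 2 +
      C.ν u (T.elem K) * (M₀ * ‖r K‖ ^ 2) := fun K => by
    have := hν K
    positivity
  -- If the sum of nonnegative terms were zero, the three projected quantities would vanish on every
  -- element, forcing z = 0.
  refine lt_of_lt_of_le ((Finset.sum_nonneg fun K _ => hnn K).lt_of_ne' fun h0 => hz0 ?_) hle
  funext K
  have h1 := (Finset.sum_eq_zero_iff_of_nonneg fun K _ => hnn K).1 h0 K (Finset.mem_univ K)
  have hνK := hν K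
  have e1 : 0 ≤ φlo * C.dm / 2 * ‖a K‖ ^ 2 := by positivity
  have e2 : 0 ≤ ‖b K‖ ^ 2 := by positivity
  have e3 : 0 ≤ C.ν u (T.elem K) * (M₀ * ‖r K‖ ^ 2) := by positivity
  have f1 : φlo * C.dm / 2 * ‖a K‖ ^ 2 = 0 := by linarith
  have f2 : ‖b K‖ ^ 2 = 0 := by linarith
  have f3 : C.ν u (T.elem K) * (M₀ * ‖r K‖ ^ 2) = 0 := by linarith
  simp only [mul_eq_zero, div_eq_zero_iff, hφlo.ne', hdm.ne', two_ne_zero, hνK.ne', hM₀.ne',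
    false_or, or_false, sq_eq_zero_iff, norm_eq_zero] at f1 f2 f3
  exact eq_zero_of_projections_eq_zero f1 f2 f3

end definite

/-! ### Solvability of the discrete problem -/

section solvability

variable {Ω : Set Pt} {T : Mesh Ω} (bd : Bool) (k : ℕ)

/-- Positivity gives coercivity in the ambient norm by finite dimension, and that norm controls the
broken one. -/
lemma coercive_of_pos {C : Coeff} {u : Pt → Pt} (h : IsBoundedData Ω C u)
    {S : (K : T.ι) → LinearMap.BilinForm ℝ (H1 (T.elem K))} {lam : ℝ}
    (hpos : ∀ z ∈ T.Zh bd k, z ≠ 0 → 0 < Γh T k C u S lam z z) : Coercive T k C u S lam bd := by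
  obtain ⟨α, hα, hle⟩ := exists_pos_mul_norm_sq_le_on (T.zh bd k) (ΓhL k h S lam) hpos
  set n : ℝ := 2 * Fintype.card T.ι
  have hn : 0 ≤ n := by positivity
  -- Dividing by n + 1 instead of n covers an empty index set of elements.
  refine ⟨α / (n + 1), by positivity, fun z hz => ?_⟩
  calc α / (n + 1) * T.normSq z ≤ α / (n + 1) * (n * ‖z‖ ^ 2) := by
        gcongr
        exact normSq_le z
    _ = n / (n + 1) * (α * ‖z‖ ^ 2) := by ring
    _ ≤ 1 * (α * ‖z‖ ^ 2) := by
        gcongr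
        rw [div_le_one (by positivity)]
        linarith
    _ ≤ _ := by
        rw [one_mul]
        exact hle z hz

/-- On the finite-dimensional space Z_h the definite broken norm dominates a multiple of the ambient
norm, in which every linear functional is bounded. The jump terms thus need no separate trace
estimate. -/
lemma exists_abs_le_mul_sqrt_normSq (l : T.BrokenH1 →ₗ[ℝ] ℝ) :
    ∃ A : ℝ, ∀ z ∈ T.Zh bd k, |l z| ≤ A * √(T.normSq z) := by
  obtain ⟨α, hα, hle⟩ := exists_pos_mul_norm_sq_le_on (T.zh bd k) (brokenInner T)
    (fun z _ hz => by rw [brokenInner_self]; exact normSq_pos hz)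
  obtain ⟨A, hA, hlA⟩ := exists_abs_le_mul_norm_on (T.zh bd k) l
  refine ⟨A / √α, fun z hz => ?_⟩
  have h2 : α * ‖z‖ ^ 2 ≤ T.normSq z := by
    rw [← brokenInner_self]
    exact hle z hz
  have h3 : √α * ‖z‖ ≤ √(T.normSq z) := by
    rw [← Real.sqrt_sq (norm_nonneg z), ← Real.sqrt_mul hα.le]
    exact Real.sqrt_le_sqrt h2
  have hα' : 0 < √α := Real.sqrt_pos.2 hα
  calc |l z| ≤ A * ‖z‖ := hlA z hz
    _ = A / √α * (√α * ‖z‖) := by field_simp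
    _ ≤ _ := by gcongr

/-- A definite bilinear form on a finite-dimensional subspace represents every linear family of
functionals, uniquely and linearly. -/
lemma exists_linear_representation {V X : Type*} [AddCommGroup V] [Module ℝ V] [AddCommGroup X]
    [Module ℝ X] (W : Submodule ℝ V) [FiniteDimensional ℝ W] (B : V →ₗ[ℝ] V →ₗ[ℝ] ℝ)
    (hB : ∀ z ∈ W, B z z = 0 → z = 0) (R : X →ₗ[ℝ] V →ₗ[ℝ] ℝ) :
    ∃ P : X →ₗ[ℝ] V, ∀ c, P c ∈ W ∧ ∀ w ∈ W, (∀ z ∈ W, B w z = R c z) ↔ w = P c := by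
  let B' : W →ₗ[ℝ] Module.Dual ℝ W := B.domRestrict₁₂ W W
  have hinj : Function.Injective B' := by
    refine (injective_iff_map_eq_zero B').2 fun z hz => ?_
    exact Subtype.ext (hB z z.2 (LinearMap.congr_fun hz z))
  -- Definiteness makes the map to the dual injective, and equal dimensions make it bijective; its
  -- inverse supplies existence, uniqueness and linearity at once.
  let e : W ≃ₗ[ℝ] Module.Dual ℝ W := LinearEquiv.ofInjectiveOfFinrankEq B' hinj
    Subspace.dual_finrank_eq.symm
  have he : ∀ w z : W, e w z = B w z := fun w z => rfl
  let R' : X →ₗ[ℝ] Module.Dual ℝ W :=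
    { toFun c := (R c).domRestrict W
      map_add' c c' := by ext z; simp
      map_smul' r c := by ext z; simp }
  have hR : ∀ c (z : W), R' c z = R c z := fun c z => rfl
  refine ⟨W.subtype ∘ₗ e.symm.toLinearMap ∘ₗ R', fun c => ⟨(e.symm (R' c)).2, fun w hw => ?_⟩⟩
  change _ ↔ w = (e.symm (R' c) : V)
  have hiff : w = (e.symm (R' c) : V) ↔ e ⟨w, hw⟩ = R' c := by
    rw [← LinearEquiv.eq_symm_apply, Subtype.ext_iff]
  rw [hiff, LinearMap.ext_iff]
  exact ⟨fun hz z => hz z z.2, fun hz z hzW => hz ⟨z, hzW⟩⟩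

end solvability

end VEM

end

/-! ### The projection is well defined. -/

theorem lemma3p7 (φlo φhi dm dl dt M : ℝ)
    (hφlo : 0 < φlo) (hdm : 0 < dm) (hdt : dm ≤ dt) (hdl : dt ≤ dl) :
    ∃ lam₀ > 0, ∀ (k : ℕ) (Ω : Set Pt), IsOpen Ω → Convex ℝ Ω → Ω.Nonempty → ∀ T : Mesh Ω,
      -- the porosity
      ∀ φ : Pt → ℝ, Measurable φ → (∀ x ∈ closure Ω, φlo ≤ φ x ∧ φ x ≤ φhi) →
      -- the velocity, a bounded Borel representative with `L^∞(Ω)` norm at most `M`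
      ∀ u : Pt → Pt, Measurable u → (∃ B : ℝ, ∀ x ∈ closure Ω, ‖u x‖ ≤ B) →
        (∀ᵐ x ∂volume.restrict Ω, ‖u x‖ ≤ M) →
      -- the stabilisation
      ∀ S : (K : T.ι) → LinearMap.BilinForm ℝ (H1 (T.elem K)),
        (∃ M₀ > 0, ∃ M₁ > 0, ∀ K, IsStabilization (T.elem K) k (S K) M₀ M₁) →
      ∀ bd : Bool,
        (∀ lam ≥ lam₀, Coercive T k ⟨φ, dm, dl, dt⟩ u S lam bd) ∧
        ∀ lam > 0, Coercive T k ⟨φ, dm, dl, dt⟩ u S lam bd →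
          (∀ c : H2 T, ∃ A : ℝ, ∀ z ∈ T.Zh bd k,
            |rhs T ⟨φ, dm, dl, dt⟩ u lam bd c z| ≤ A * √(T.normSq z)) ∧
          ∃ P : H2 T →ₗ[ℝ] T.BrokenH1, ∀ c : H2 T, P c ∈ T.Zh bd k ∧
            ∀ w ∈ T.Zh bd k,
              (∀ z ∈ T.Zh bd k,
                Γh T k ⟨φ, dm, dl, dt⟩ u S lam w z = rhs T ⟨φ, dm, dl, dt⟩ u lam bd c z) ↔
              w = P c := by
  have hdt0 : 0 < dt := hdm.trans_le hdt
  have hdl0 : 0 < dl := hdt0.trans_le hdl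
  -- The threshold from Young's inequality; it is fixed before the degree, the domain, the mesh and
  -- the stabilisation are introduced.
  refine ⟨M ^ 2 / (2 * (φlo * dm)) + 1, by positivity, ?_⟩
  rintro k Ω - - - T φ hφm hφ u hum hub huM S ⟨M₀, hM₀, M₁, -, hS⟩ bd
  have h : IsBoundedData Ω ⟨φ, dm, dl, dt⟩ u :=
    ⟨hφm, hum, ⟨φhi, fun x hx => abs_le.2 ⟨by linarith [hφ x hx], (hφ x hx).2⟩⟩, hub⟩
  refine ⟨fun lam hlam => coercive_of_pos bd k h fun z hz hz0 =>
    Γh_self_pos h (fun x hx => (hφ x hx).1) hφlo hdm hdl0.le hdt0.le huM hlam hM₀ hS hz hz0,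
    fun lam _ hco => ⟨fun c => exists_abs_le_mul_sqrt_normSq bd k (rhsL h lam bd c), ?_⟩⟩
  obtain ⟨α, hα, hle⟩ := hco
  -- Of coercivity only definiteness is needed here: a nonzero z in Z_h would give Γ(z, z) ≥ α‖z‖² >
  -- 0.
  refine exists_linear_representation (T.zh bd k) (ΓhL k h S lam) (fun z hz h0 => ?_)
    (rhsL h lam bd)
  by_contra hz0
  have h1 := hle z hz
  have h2 := mul_pos hα (normSq_pos hz0)
  change Γh T k ⟨φ, dm, dl, dt⟩ u S lam z z = 0 at h0
  linarith
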